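/- Let $p$ be a prime, $S$ a finite $p$-group and $\mathcal F$ an Alperin fusion system on $S$ with associated subgroups $S=P_1,\dots,P_l$ of $S$ and finite groups $L_1,\dots,L_l$. That is: $N_S(P_i)$ is identified with a Sylow $p$-subgroup of $L_i$, in such a way that $P_i=O_p(L_i)$ and $C_{L_i}(P_i)=Z(P_i)$; $L_i/P_i\cong \mathrm{Out}_{\mathcal F}(P_i)$; and $\mathcal F$ is generated by (is the smallest fusion system on $S$ containing) the fusion systems $\mathcal F_{N_S(P_i)}(L_i)$. For each $i$ choose finitely many subgroups of $L_i$ which generate $L_i$ and each of which contains an isomorphic copy of $N_S(P_i)$. List all the chosen subgroups, for all $i$, as $K_1,\dots,K_n$, where $S\in \mathrm{Syl}_p(K_1)$; if $K_j$ was chosen in $L_i$, write from now on $P_j$ for the subgroup $P_i$. Fix an embedding $N_S(P_j)\hookrightarrow K_j$ for each $j$ (for $j=1$ this is an embedding $S\hookrightarrow K_1$), and let $$G=K_1\underset{N_S(P_2)}{*}K_2\underset{N_S(P_3)}{*}\cdots\underset{N_S(P_n)}{*}K_n$$ be the iterated amalgam in which each $K_j$ is glued to $K_1\ge S$ along $N_S(P_j)$.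 For a $kG$-module $X$, $\mathrm{Res}^G_{K_j}(X)$ denotes restriction along the canonical map $K_j\to G$, and $C_G(X)$ denotes the kernel of the action of $G$ on $X$. Let $k$ be a field of characteristic $p$. (1) For $1\le j\le n$ let $X_j$ be a finite-dimensional projective $kK_j$-module, and suppose that all $X_j$ have equal dimension $d$. Then there is a $kG$-module $X$ such that $\mathrm{Res}^G_{K_j}(X)\cong X_j$ for each $j$ and such that $C_G(X)$ is a normal subgroup of $G$ of finite index which, if $d>0$, is a free group. (2) For each $j$ let $V_j$ be a simple $kK_j$-module. Then there is a nonzero finite-dimensional $kG$-module $W$ such that for each $j$ the restriction $\mathrm{Res}^G_{K_j}(W)$ is a projective $kK_j$-module and $\mathrm{soc}(\mathrm{Res}^G_{K_j}(W))$ is isomorphic to a direct sum of copies of $V_j$. Moreover, $W$ has a simple $kG$-submodule $U$ such that for each $j$ $\mathrm{soc}(\mathrm{Res}^G_{K_j}(U))$ is isomorphic to a direct sum of copies of $V_j$. -/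

import Mathlib

open scoped MonoidAlgebra

universe u w

/-- A fusion system on a group `S`: a category whose objects are the subgroups of `S`, whose
morphisms are injective group homomorphisms (composed as such), which contains all homomorphisms
induced by conjugation with elements of `S` (in particular identities and inclusions), and in which
every morphism is an isomorphism of the category followed by an inclusion. -/
structure FusionSystem (S : Type*) [Group S] where
  Hom (P Q : Subgroup S) : Set (P →* Q)
  injective_of_mem {P Q : Subgroup S} {φ : P →* Q} : φ ∈ Hom P Q → Function.Injective φ
  conj_mem {P Q : Subgroup S} (s : S) (φ : P →* Q) :
    (∀ x : P, (φ x : S) = s * x * s⁻¹) → φ ∈ Hom P Q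
  comp_mem {P Q R : Subgroup S} {φ : P →* Q} {ψ : Q →* R} :
    φ ∈ Hom P Q → ψ ∈ Hom Q R → ψ.comp φ ∈ Hom P R
  factor {P Q : Subgroup S} {φ : P →* Q} : φ ∈ Hom P Q →
    ∃ (R : Subgroup S) (hR : R ≤ Q) (ψ : P ≃* R),
      ψ.toMonoidHom ∈ Hom P R ∧ ψ.symm.toMonoidHom ∈ Hom R P ∧
        φ = (Subgroup.inclusion hR).comp ψ.toMonoidHom

namespace FusionSystem

variable {S : Type*} [Group S] (F : FusionSystem S)

/-- `Aut_F(P)`: the automorphisms of the object `P` in the category `F`. -/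
def Aut (P : Subgroup S) : Subgroup (MulAut P) where
  carrier := {α | MulEquiv.toMonoidHom α ∈ F.Hom P P ∧ MulEquiv.toMonoidHom α⁻¹ ∈ F.Hom P P}
  one_mem' := by
    constructor
    · exact F.conj_mem 1 _ (fun x => by simp)
    · exact F.conj_mem 1 _ (fun x => by simp)
  mul_mem' := by
    rintro α β ⟨ha, ha'⟩ ⟨hb, hb'⟩
    refine ⟨F.comp_mem hb ha, ?_⟩
    rw [mul_inv_rev]
    exact F.comp_mem ha' hb'
  inv_mem' := by
    rintro α ⟨ha, ha'⟩
    exact ⟨ha', by simpa using ha⟩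

/-- `Inn(P)`, as a subgroup of `Aut_F(P)`. -/
def Inn (P : Subgroup S) : Subgroup (F.Aut P) :=
  (MulAut.conj : P →* MulAut P).range.subgroupOf (F.Aut P)

/-- All inner automorphisms of `P` lie in `Aut_F(P)`. -/
theorem range_conj_le_aut (P : Subgroup S) : (MulAut.conj : P →* MulAut P).range ≤ F.Aut P := by
  rintro _ ⟨x, rfl⟩
  constructor
  · exact F.conj_mem (x : S) _ (fun y => by simp)
  · refine F.conj_mem ((x : S)⁻¹) _ (fun y => ?_)
    rw [← map_inv]
    simp

instance inn_normal (P : Subgroup S) : (F.Inn P).Normal := by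
  refine ⟨?_⟩
  rintro ⟨_, _⟩ ⟨x, hx⟩ ⟨β, hβ⟩
  refine ⟨β x, ?_⟩
  change MulAut.conj x = _ at hx
  ext y
  have h : ∀ z : P, x * z * x⁻¹ = _ := fun z => DFunLike.congr_fun hx z
  simp only [Subgroup.subtype_apply] at h
  simp [← h]

/-- `Out_F(P) = Aut_F(P) / Inn(P)`. -/
abbrev Out (P : Subgroup S) : Type _ := F.Aut P ⧸ F.Inn P

/-- Let `N ≤ S` be identified with a subgroup of a group `L` by `e : N →* L`.
`F.ContainsFusion e` says that the fusion system `F_N(L)` is contained in `F`: every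
homomorphism `A → B` between subgroups of `N` that is induced by conjugation with an element
of `L` is a morphism of `F`. -/
def ContainsFusion {N : Subgroup S} {L : Type*} [Group L] (e : N →* L) : Prop :=
  ∀ (A B : Subgroup S) (hA : A ≤ N) (hB : B ≤ N) (g : L) (φ : A →* B),
    (∀ x : A, e (Subgroup.inclusion hB (φ x)) = g * e (Subgroup.inclusion hA x) * g⁻¹) →
      φ ∈ F.Hom A B

end FusionSystem

/-- `O_p(L)`: the largest normal `p`-subgroup of a finite group `L`. -/
def pCore (p : ℕ) (L : Type*) [Group L] : Subgroup L :=
  sSup {N : Subgroup L | N.Normal ∧ IsPGroup p N}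

instance pCore_normal (p : ℕ) (L : Type*) [Group L] : (pCore p L).Normal :=
  Subgroup.sSup_normal _ (fun _ h => h.1)

/-- The data exhibiting `F` as an Alperin fusion system with associated finite groups
`L 0, ..., L r`: subgroups `P 0 = S, P 1, ..., P r` of `S` and identifications `incl i` of
`N_S(P i)` with a Sylow `p`-subgroup of `L i`, such that, inside `L i`, `P i = O_p(L i)` and
`C_{L i}(P i) = Z(P i)`; `L i / P i` is isomorphic to `Out_F(P i)`; and `F` is the smallest
fusion system containing all the fusion systems of `L i` on `N_S(P i)`. -/
structure AlperinFamily (p : ℕ) {S : Type*} [Group S] (F : FusionSystem S) {r : ℕ}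
    (L : Fin (r + 1) → Type*) [∀ i, Group (L i)] where
  P : Fin (r + 1) → Subgroup S
  P_zero : P 0 = ⊤
  incl : ∀ i, Subgroup.normalizer (P i : Set S) →* L i
  incl_injective : ∀ i, Function.Injective (incl i)
  range_incl : ∀ i, ∃ Q : Sylow p (L i), (incl i).range = (Q : Subgroup (L i))
  map_P : ∀ i, ((P i).subgroupOf (Subgroup.normalizer (P i : Set S))).map (incl i) = pCore p (L i)
  centralizer_core : ∀ i, Subgroup.centralizer (pCore p (L i) : Set (L i)) =
    (Subgroup.center (pCore p (L i))).map (pCore p (L i)).subtype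
  out_equiv : ∀ i, Nonempty (L i ⧸ pCore p (L i) ≃* F.Out (P i))
  containsFusion : ∀ i, F.ContainsFusion (incl i)
  generates : ∀ F' : FusionSystem S, (∀ i, F'.ContainsFusion (incl i)) →
    ∀ A B : Subgroup S, F.Hom A B ⊆ F'.Hom A B

/-- The choices made in the construction of the group model. For each `i`, subgroups `K ⟨i, t⟩`
(`t : Fin (m i)`) generating `L i`, each containing an isomorphic copy of `N_S(P i)`, given by an
injective homomorphism `ν ⟨i, t⟩`. One of them, `K base` (called `K_1` in the usual enumeration),
belongs to an `i` with `N_S(P i) = S`, so that `S` is identified by `ν base` with a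
Sylow `p`-subgroup of `K base`. -/
structure ModelData {p : ℕ} {S : Type*} [Group S] {F : FusionSystem S} {r : ℕ}
    {L : Fin (r + 1) → Type*} [∀ i, Group (L i)] (A : AlperinFamily p F L)
    (m : Fin (r + 1) → ℕ) where
  K : ∀ j : (Σ i, Fin (m i)), Subgroup (L j.1)
  iSup_K : ∀ i, (⨆ t : Fin (m i), K ⟨i, t⟩ : Subgroup (L i)) = ⊤
  ν : ∀ j : (Σ i, Fin (m i)), Subgroup.normalizer (A.P j.1 : Set S) →* K j
  ν_injective : ∀ j, Function.Injective (ν j)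
  base : Σ i, Fin (m i)
  normalizer_base : Subgroup.normalizer (A.P base.1 : Set S) = ⊤

namespace ModelData

variable {p : ℕ} {S : Type*} [Group S] {F : FusionSystem S} {r : ℕ}
  {L : Fin (r + 1) → Type*} [∀ i, Group (L i)] {A : AlperinFamily p F L}
  {m : Fin (r + 1) → ℕ} (M : ModelData A m)

/-- The elements of the free product of the `K j` that are killed in the amalgam: they identify the
copy of `x ∈ N_S(P_j)` in `K j` with the copy of `x ∈ S` in `K base`.
(The second membership always holds, as `N_S(P_base) = S`.) -/
def relators : Set (Monoid.CoprodI fun j => M.K j) :=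
  {w | ∃ (j : Σ i, Fin (m i)) (x : S) (hx : x ∈ Subgroup.normalizer (A.P j.1 : Set S))
      (hx' : x ∈ Subgroup.normalizer (A.P M.base.1 : Set S)),
    w = (Monoid.CoprodI.of (M := fun j => M.K j) (M.ν M.base ⟨x, hx'⟩))⁻¹ *
      Monoid.CoprodI.of (M := fun j => M.K j) (M.ν j ⟨x, hx⟩)}

/-- The group model `G = K_1 *_{N_S(P_2)} K_2 *_{N_S(P_3)} ... *_{N_S(P_n)} K_n`:
the iterated amalgam, in which each `K_j` is glued to `K_1 ≥ S` along `N_S(P_j)`. -/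
abbrev G : Type _ := Monoid.CoprodI (fun j => M.K j) ⧸ Subgroup.normalClosure M.relators

/-- The canonical homomorphism `K_j → G`. -/
def of (j : Σ i, Fin (m i)) : M.K j →* M.G :=
  (QuotientGroup.mk' (Subgroup.normalClosure M.relators)).comp
    (Monoid.CoprodI.of (M := fun j => M.K j))

/-- The restriction of a representation of `G` to `K_j`. -/
def res {k V : Type*} [CommSemiring k] [AddCommMonoid V] [Module k V]
    (τ : Representation k M.G V) (j : Σ i, Fin (m i)) : Representation k (M.K j) V :=
  τ.comp (M.of j)

end ModelData

/-- The socle of a module: the sum of its simple submodules. -/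
def socle (R M : Type*) [Ring R] [AddCommGroup M] [Module R M] : Submodule R M :=
  sSup {N : Submodule R M | IsSimpleModule R N}

/-- The socle of the `k[H]`-module of `ρ` is isomorphic to a finite direct sum of copies of the
`k[H]`-module of `σ`. -/
def SocleIsSumOfCopies {k H V W : Type*} [Field k] [Group H] [AddCommGroup V] [Module k V]
    [AddCommGroup W] [Module k W] (ρ : Representation k H V) (σ : Representation k H W) : Prop :=
  ∃ c : ℕ, Nonempty (socle k[H] ρ.asModule ≃ₗ[k[H]] (Fin c → σ.asModule))

/-! Restricted to the `p`-group `N_S(P_j)`, a finite-dimensional projective module in characteristic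
`p` is free, so its dimension determines it. Projective `K_j`-modules of equal dimension therefore
agree, up to isomorphism, on the glued subgroups; conjugating each action by such an isomorphism
turns them into one action of the amalgam (`ModelData.exists_glue`).

Over an arbitrary `k` the conjugating matrices could generate an infinite group. So let `a` be the
algebraic closure of the prime field in `k`. Every finite-dimensional projective module is defined
over `a` (`HasTraceOne.descends`). If the gluing is done over `a`, finitely many matrix entries, all
algebraic over the prime field, describe the whole action; the image of `G` is finite and stays so
after extension to `k`.

A nonzero projective module of `K_j` is faithful: its kernel has no elements of order `p`, so it
commutes with `O_p(L_j)`, which lies in `K_j` and has centralizer `Z(O_p(L_j))`, a `p`-group. Hence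
`C_G(X)` meets the factors trivially, acts freely on the Bass-Serre tree and is free
(`ModelData.isFreeGroup_ker`).

For (2), part (1) is applied to multiples of the injective hulls `E_j` of the `V_j`, with
multiplicities that equalize dimensions. All simple `K_j`-submodules are then isomorphic to `V_j`,
and this passes to any simple `G`-submodule. -/

open scoped TensorProduct

/-! ### Freeness of normal subgroups that meet the factors trivially -/

/-- The element `φ (κ h) * h` depends only on the right coset of `h` modulo the image of `φ`: such a
`κ` amounts to a choice of coset representatives. -/
theorem MonoidHom.exists_coset_coordinate {A H : Type*} [Group A] [Group H] (φ : A →* H)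
    (hφ : Function.Injective φ) : ∃ κ : H → A, ∀ a h, κ (φ a * h) = κ h * a⁻¹ := by
  have key : ∀ h : H, ∃ a : A,
      φ a * h = Quotient.out (s := QuotientGroup.rightRel φ.range)
        (Quotient.mk (QuotientGroup.rightRel φ.range) h) := by
    intro h
    have h1 := (QuotientGroup.rightRel φ.range).symm
      (Quotient.mk_out (s := QuotientGroup.rightRel φ.range) h)
    obtain ⟨a, ha⟩ := QuotientGroup.rightRel_apply.1 h1
    exact ⟨a, by rw [ha]; group⟩
  choose κ hκ using key
  refine ⟨κ, fun a h => hφ ?_⟩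
  have h1 := hκ (φ a * h)
  have h2 : Quotient.mk (QuotientGroup.rightRel φ.range) (φ a * h) =
      Quotient.mk (QuotientGroup.rightRel φ.range) h := by
    apply Quotient.sound
    exact QuotientGroup.rightRel_apply.2 ⟨a⁻¹, by simp⟩
  rw [h2, ← hκ h, ← mul_assoc, mul_left_inj] at h1
  rw [map_mul, map_inv, eq_mul_inv_iff_mul_eq, h1]

/-- The permutation of `V × X` that exchanges the fibres over `v` and `v'`, acting on the first one
by left multiplication by `a`. -/
noncomputable def swapFibres {V X : Type*} [Group X] (v v' : V) (hv : v ≠ v') (a : X) :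
    Equiv.Perm (V × X) :=
  open Classical in
  Function.Involutive.toPerm
    (fun z => if z.1 = v then (v', a * z.2) else if z.1 = v' then (v, a⁻¹ * z.2) else z) (by
      rintro ⟨z, x⟩
      by_cases h : z = v
      · subst h; simp [hv.symm]
      · by_cases h' : z = v'
        · subst h'; simp [h]
        · simp [h, h'])

theorem swapFibres_apply {V X : Type*} [Group X] {v v' : V} (hv : v ≠ v') (a x : X) :
    swapFibres v v' hv a (v, x) = (v', a * x) := by
  exact if_pos rfl

namespace ModelData

variable {p : ℕ} {S : Type*} [Group S] {F : FusionSystem S} {r : ℕ}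
  {L : Fin (r + 1) → Type*} [∀ i, Group (L i)] {A : AlperinFamily p F L}
  {m : Fin (r + 1) → ℕ} (M : ModelData A m)

/-- The embedding of `S` in `K_1`. -/
def baseEmb : S →* M.K M.base where
  toFun x := M.ν M.base ⟨x, M.normalizer_base ▸ Subgroup.mem_top x⟩
  map_one' := map_one (M.ν M.base)
  map_mul' x y := map_mul (M.ν M.base) ⟨x, M.normalizer_base ▸ Subgroup.mem_top x⟩
    ⟨y, M.normalizer_base ▸ Subgroup.mem_top y⟩

theorem baseEmb_injective : Function.Injective M.baseEmb := fun x y h => by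
  have := M.ν_injective M.base h
  simpa using this

theorem of_ν (j : Σ i, Fin (m i)) (x : Subgroup.normalizer (A.P j.1 : Set S)) :
    M.of j (M.ν j x) = M.of M.base (M.baseEmb x) := by
  symm
  refine (QuotientGroup.eq).2 (Subgroup.subset_normalClosure ?_)
  exact ⟨j, x, x.2, M.normalizer_base ▸ Subgroup.mem_top _, rfl⟩

/-- The universal property of the amalgam. -/
def lift {X : Type*} [Monoid X] (f : ∀ j, M.K j →* X)
    (hf : ∀ (j : Σ i, Fin (m i)) (x : Subgroup.normalizer (A.P j.1 : Set S)),
      f j (M.ν j x) = f M.base (M.baseEmb x)) : M.G →* X :=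
  QuotientGroup.lift _ (Monoid.CoprodI.lift f) (by
    refine Subgroup.normalClosure_le_normal ?_
    rintro _ ⟨j, x, hx, hx', rfl⟩
    have h : M.ν M.base ⟨x, hx'⟩ = M.baseEmb x := rfl
    change Monoid.CoprodI.lift f _ = 1
    rw [map_mul, ← map_inv, Monoid.CoprodI.lift_of, Monoid.CoprodI.lift_of, hf j ⟨x, hx⟩, h,
      ← map_mul]
    simp)

theorem lift_of {X : Type*} [Monoid X] (f : ∀ j, M.K j →* X) (hf) (j : Σ i, Fin (m i))
    (g : M.K j) : M.lift f hf (M.of j g) = f j g :=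
  Monoid.CoprodI.lift_of f g

theorem induction_on {q : M.G → Prop} (x : M.G) (one : q 1) (of : ∀ j g, q (M.of j g))
    (mul : ∀ x y, q x → q y → q (x * y)) : q x := by
  induction x using QuotientGroup.induction_on with
  | H z =>
    induction z using Monoid.CoprodI.induction_on with
    | one => exact one
    | of i g => exact of i g
    | mul x y hx hy => exact mul _ _ hx hy

/-- A normal subgroup of the amalgam that meets all the factors `K_j` trivially is free. -/
theorem isFreeGroup_ker {H : Type*} [Group H] (φ : M.G →* H)
    (hφ : ∀ j, Function.Injective (φ.comp (M.of j))) : IsFreeGroup φ.ker := by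
  classical
  let ι : S →* M.G := (M.of M.base).comp M.baseEmb
  have hι : ∀ j x, M.of j (M.ν j x) = ι x := M.of_ν
  have hφι : Function.Injective (φ.comp ι) := (hφ M.base).comp M.baseEmb_injective
  choose κ hκ using fun j => MonoidHom.exists_coset_coordinate (φ.comp (M.of j)) (hφ j)
  obtain ⟨σ, hσ⟩ := MonoidHom.exists_coset_coordinate (φ.comp ι) hφι
  choose η hη using fun j => MonoidHom.exists_coset_coordinate
    ((φ.comp (M.of j)).comp (M.ν j)) ((hφ j).comp (M.ν_injective j))
  simp only [MonoidHom.comp_apply] at hκ hσ hη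
  -- Bass-Serre theory made explicit. The quotient of the tree by the kernel is modelled by a graph
  -- with vertices the cosets of `S` and of the `K_j` in `H` and edges the cosets of the `N_S(P_j)`;
  -- `ρS`, `ρK`, `ρN` pick the representatives. The element `θ j q` of `G` compares the two chosen
  -- representatives at the ends of an edge.
  let ρS : H → H := fun q => φ (ι (σ q)) * q
  let ρK : ∀ j, H → H := fun j q => φ (M.of j (κ j q)) * q
  let θ : ∀ j, H → M.G := fun j q => M.of j (κ j q) * (ι (σ q))⁻¹
  let ρN : ∀ j, H → H := fun j q => φ (M.of j (M.ν j (η j q))) * q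
  have hρK : ∀ j g q, ρK j (φ (M.of j g) * q) = ρK j q := by
    intro j g q
    simp only [ρK, hκ, map_mul, map_inv]; group
  have hρN : ∀ j n q, ρN j (φ (M.of j (M.ν j n)) * q) = ρN j q := by
    intro j g q
    simp only [ρN, hη, map_mul, map_inv]; group
  have hρSN : ∀ j q, ρS (ρN j q) = ρS q := by
    intro j q
    simp only [ρS, ρN, hι, hσ, map_mul, map_inv]; group
  have hρKN : ∀ j q, ρK j (ρN j q) = ρK j q := fun j q => hρK j _ q
  have hθN : ∀ j q, θ j (ρN j q) = θ j q := by
    intro j q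
    have h1 := hκ j (M.ν j (η j q)) q
    have h2 : σ (φ (M.of j (M.ν j (η j q))) * q) = σ q * (η j q : S)⁻¹ := by rw [hι, hσ]
    simp only [θ, ρN, h1, h2, map_mul, map_inv, ← hι]
    group
  -- One free generator for each edge; basis elements whose second entry is not a representative are
  -- never used.
  let t : ∀ j, H → FreeGroup ((Σ i, Fin (m i)) × H) := fun j q => FreeGroup.of (j, ρN j q)
  have ht : ∀ j n q, t j (φ (M.of j (M.ν j n)) * q) = t j q := by
    intro j n q; simp only [t, hρN]
  let T : ∀ j, Equiv.Perm (H × FreeGroup ((Σ i, Fin (m i)) × H)) := fun j =>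
    { toFun := fun z => (z.1, t j z.1 * z.2)
      invFun := fun z => (z.1, (t j z.1)⁻¹ * z.2)
      left_inv := fun z => by simp
      right_inv := fun z => by simp }
  let D : H →* Equiv.Perm (H × FreeGroup ((Σ i, Fin (m i)) × H)) :=
    { toFun := fun h => (Equiv.mulLeft h).prodCongr (Equiv.refl _)
      map_one' := by ext z <;> simp
      map_mul' := fun a b => by ext z <;> simp [mul_assoc] }
  -- Left translation on `H`, twisted by the coboundary of `t j`. Since `t j` is constant on cosets
  -- of `N_S(P_j)`, the twist disappears there, and the `f j` agree on the glued subgroups.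
  let f : ∀ j, M.K j →* Equiv.Perm (H × FreeGroup ((Σ i, Fin (m i)) × H)) := fun j =>
    (MulAut.conj (T j)⁻¹).toMonoidHom.comp (D.comp (φ.comp (M.of j)))
  have hf : ∀ j g q x, f j g (q, x) =
      (φ (M.of j g) * q, (t j (φ (M.of j g) * q))⁻¹ * t j q * x) := by
    intro j g q x
    change (T j).symm (D (φ (M.of j g)) (T j (q, x))) = _
    simp [T, D, mul_assoc]
  have hfν : ∀ j x, f j (M.ν j x) = D (φ (ι x)) := by
    intro j x
    ext1 ⟨q, y⟩
    rw [hf, ht]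
    simp [D, hι]
  let C : M.G →* _ := M.lift f (fun j x => by
    rw [hfν]
    exact (hfν M.base ⟨x, _⟩).symm)
  have hC : ∀ j g, C (M.of j g) = f j g := M.lift_of f _
  -- The other direction: an edge carries the fibre over its `S`-vertex to the fibre over its
  -- `K_j`-vertex, multiplying by `θ`. Exchanging the two fibres makes this a permutation, as a
  -- homomorphism from a free group requires.
  let P : FreeGroup ((Σ i, Fin (m i)) × H) →*
      Equiv.Perm ((Option (Σ i, Fin (m i)) × H) × M.G) :=
    FreeGroup.lift fun e => swapFibres (none, ρS e.2) (some e.1, ρK e.1 e.2) (by simp) (θ e.1 e.2)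
  have hPt : ∀ j q y, P (t j q) ((none, ρS q), y) = ((some j, ρK j q), θ j q * y) := by
    intro j q y
    have h : ((none, ρS q) : Option (Σ i, Fin (m i)) × H) = (none, ρS (ρN j q)) := by rw [hρSN]
    simp only [P, t, FreeGroup.lift_apply_of]
    rw [h, swapFibres_apply, hρKN, hθN]
  have hPt' : ∀ j q y, (P (t j q))⁻¹ ((some j, ρK j q), y) = ((none, ρS q), (θ j q)⁻¹ * y) := by
    intro j q y
    rw [Equiv.Perm.inv_eq_iff_eq, hPt, mul_inv_cancel_left]
  -- The word `c` records the path in the graph traced by `w` from the `S`-vertex of `q`; an element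
  -- of `K_j` goes along an edge to a `K_j`-vertex and returns along another. Acting through `P`,
  -- this path gives back `w` up to the chosen representatives.
  have key : ∀ w q, ∃ c, (∀ x, C w (q, x) = (φ w * q, c * x)) ∧
      ∀ y, P c ((none, ρS q), y) =
        ((none, ρS (φ w * q)), ι (σ (φ w * q)) * w * (ι (σ q))⁻¹ * y) := by
    intro w
    induction w using M.induction_on with
    | one => exact fun q => ⟨1, by simp, by simp⟩
    | of j g =>
      refine fun q => ⟨(t j (φ (M.of j g) * q))⁻¹ * t j q, fun x => by rw [hC, hf], fun y => ?_⟩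
      rw [map_mul, map_inv, Equiv.Perm.mul_apply, hPt, ← hρK j g q, hPt']
      simp only [θ, hκ, map_mul, map_inv]
      congr 1
      group
    | mul a b ha hb =>
      intro q
      obtain ⟨c, hc, hc'⟩ := hb q
      obtain ⟨d, hd, hd'⟩ := ha (φ b * q)
      refine ⟨d * c, fun x => ?_, fun y => ?_⟩
      · rw [map_mul, Equiv.Perm.mul_apply, hc, hd, map_mul, mul_assoc, mul_assoc]
      · rw [map_mul, Equiv.Perm.mul_apply, hc', hd', map_mul, mul_assoc (φ a)]
        congr 1
        group
  choose c hcC hcP using key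
  have hcmul : ∀ a b : φ.ker, c (a * b) 1 = c a 1 * c b 1 := by
    intro a b
    have h := hcC (a * b) 1 1
    have hb := (MonoidHom.mem_ker (f := φ)).1 b.2
    rw [map_mul, Equiv.Perm.mul_apply, hcC b, hb, one_mul, hcC] at h
    simpa using (congrArg Prod.snd h).symm
  let Φ : φ.ker →* FreeGroup ((Σ i, Fin (m i)) × H) :=
    MonoidHom.mk' (fun a => c a 1) hcmul
  have hΦ : Function.Injective Φ := by
    rw [injective_iff_map_eq_one]
    intro a ha
    have h := hcP a 1 1
    have hc1 : c (a : M.G) 1 = 1 := ha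
    rw [hc1, (MonoidHom.mem_ker (f := φ)).1 a.2, map_one] at h
    have h2 := congrArg Prod.snd h
    simp only [Equiv.Perm.one_apply, mul_one] at h2
    ext
    have h3 := mul_inv_eq_one.1 h2.symm
    simpa using h3
  -- The kernel embeds in a free group, and subgroups of free groups are free by Nielsen-Schreier.
  exact IsFreeGroup.ofMulEquiv (MonoidHom.ofInjective hΦ).symm

end ModelData

/-! ### Projectivity by the trace criterion -/

namespace Representation

section General

variable {k G V W : Type*} [Field k] [Group G] [AddCommGroup V] [Module k V]
  [AddCommGroup W] [Module k W]

theorem ofModule'_apply {M : Type*} [AddCommGroup M] [Module k M] [Module k[G] M]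
    [IsScalarTower k k[G] M] (g : G) (x : M) :
    (ofModule' M : Representation k G M) g x = MonoidAlgebra.single g (1 : k) • x := by
  simp [ofModule']

theorem asModuleEquiv_ofModule' (ρ : Representation k G V) (g : G) (x : ρ.asModule) :
    ρ.asModuleEquiv ((ofModule' ρ.asModule : Representation k G ρ.asModule) g x) =
      ρ g (ρ.asModuleEquiv x) := by
  rw [ofModule'_apply, asModuleEquiv_map_smul, asAlgebraHom_single, one_smul]

/-- A `k`-linear map commuting with the group is `k[G]`-linear. -/
def moduleHom {M N : Type*} [AddCommGroup M] [Module k M] [Module k[G] M]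
    [IsScalarTower k k[G] M] [AddCommGroup N] [Module k N] [Module k[G] N]
    [IsScalarTower k k[G] N] (f : M →ₗ[k] N)
    (hf : ∀ g x, f ((ofModule' M : Representation k G M) g x) =
      (ofModule' N : Representation k G N) g (f x)) : M →ₗ[k[G]] N :=
  MonoidAlgebra.equivariantOfLinearOfComm f fun g x => by
    simpa only [ofModule'_apply] using hf g x

@[simp]
theorem moduleHom_apply {M N : Type*} [AddCommGroup M] [Module k M] [Module k[G] M]
    [IsScalarTower k k[G] M] [AddCommGroup N] [Module k N] [Module k[G] N]
    [IsScalarTower k k[G] N] (f : M →ₗ[k] N)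
    (hf : ∀ g x, f ((ofModule' M : Representation k G M) g x) =
      (ofModule' N : Representation k G N) g (f x)) (x : M) : moduleHom f hf x = f x := rfl

theorem map_ofModule' {M N : Type*} [AddCommGroup M] [Module k M] [Module k[G] M]
    [IsScalarTower k k[G] M] [AddCommGroup N] [Module k N] [Module k[G] N]
    [IsScalarTower k k[G] N] (f : M →ₗ[k[G]] N) (g : G) (x : M) :
    f ((ofModule' M : Representation k G M) g x) =
      (ofModule' N : Representation k G N) g (f x) := by
  simp only [ofModule'_apply, map_smul]

variable [Fintype G]

/-- The trace criterion for projectivity: the identity is the trace of some `k`-linear map. -/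
def HasTraceOne (ρ : Representation k G V) : Prop :=
  ∃ θ : V →ₗ[k] V, ∀ x, ∑ g, ρ g (θ (ρ g⁻¹ x)) = x

theorem HasTraceOne.of_retract {ρ : Representation k G V} {σ : Representation k G W}
    (h : HasTraceOne ρ) (i : W →ₗ[k] V) (q : V →ₗ[k] W) (hi : ∀ g x, i (σ g x) = ρ g (i x))
    (hq : ∀ g x, q (ρ g x) = σ g (q x)) (hqi : ∀ x, q (i x) = x) : HasTraceOne σ := by
  obtain ⟨θ, hθ⟩ := h
  refine ⟨q ∘ₗ θ ∘ₗ i, fun x => ?_⟩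
  simp only [LinearMap.comp_apply, hi, ← hq]
  rw [← map_sum, hθ, hqi]

theorem HasTraceOne.pi {ι : Type*} {M : Type*} [AddCommGroup M] [Module k M] [Module k[G] M]
    [IsScalarTower k k[G] M] (h : HasTraceOne (ofModule' M : Representation k G M)) :
    HasTraceOne (ofModule' (ι → M) : Representation k G (ι → M)) := by
  obtain ⟨θ, hθ⟩ := h
  refine ⟨LinearMap.pi fun i => θ ∘ₗ LinearMap.proj i, fun x => ?_⟩
  ext i
  have := hθ (x i)
  simp only [ofModule'_apply] at this ⊢
  simpa [Finset.sum_apply] using this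

theorem HasTraceOne.finsupp {ι : Type*} {M : Type*} [AddCommGroup M] [Module k M] [Module k[G] M]
    [IsScalarTower k k[G] M] (h : HasTraceOne (ofModule' M : Representation k G M)) :
    HasTraceOne (ofModule' (ι →₀ M) : Representation k G (ι →₀ M)) := by
  obtain ⟨θ, hθ⟩ := h
  refine ⟨Finsupp.mapRange.linearMap θ, fun x => ?_⟩
  ext i
  have := hθ (x i)
  simp only [ofModule'_apply] at this ⊢
  simpa [Finsupp.finsetSum_apply] using this

theorem HasTraceOne.prod {ρ : Representation k G V} {σ : Representation k G W}
    (h : HasTraceOne ρ) (h' : HasTraceOne σ) : HasTraceOne (ρ.prod σ) := by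
  obtain ⟨θ, hθ⟩ := h
  obtain ⟨θ', hθ'⟩ := h'
  refine ⟨θ.prodMap θ', fun x => ?_⟩
  ext
  · simpa [Prod.fst_sum] using hθ x.1
  · simpa [Prod.snd_sum] using hθ' x.2

theorem hasTraceOne_regular : HasTraceOne (ofModule' k[G] : Representation k G k[G]) := by
  let θ : k[G] →ₗ[k] k[G] :=
    { toFun := fun x => MonoidAlgebra.single 1 (x.coeff 1)
      map_add' := fun x y => by simp
      map_smul' := fun c x => by simp }
  have hθ : ∀ x, θ x = MonoidAlgebra.single 1 (x.coeff 1) := fun _ => rfl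
  refine ⟨θ, fun x => ?_⟩
  classical
  ext h
  simp only [ofModule'_apply]
  simp [hθ]

theorem HasTraceOne.comp {H : Type*} [Group H] [Fintype H] {ρ : Representation k G V}
    (h : HasTraceOne ρ) (ν : H →* G) (hν : Function.Injective ν) : HasTraceOne (ρ.comp ν) := by
  classical
  obtain ⟨θ, hθ⟩ := h
  obtain ⟨κ, hκ⟩ := ν.exists_coset_coordinate hν
  -- The elements with `κ g = 1` form a transversal of the right cosets of the image of `H`; summing
  -- over it first leaves a trace over `H`.
  refine ⟨∑ t : {g // κ g = 1}, ρ t ∘ₗ θ ∘ₗ ρ (t⁻¹ : G), fun x => ?_⟩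
  conv_rhs => rw [← hθ x]
  let e : H × {g // κ g = 1} ≃ G :=
    { toFun := fun z => ν z.1 * z.2
      invFun := fun g => ((κ g)⁻¹, ⟨ν (κ g) * g, by simp [hκ]⟩)
      left_inv := fun z => by
        rcases z with ⟨a, t, ht⟩
        simp [hκ, ht]
      right_inv := fun g => by simp }
  rw [← e.sum_comp, Fintype.sum_prod_type]
  refine Finset.sum_congr rfl fun a _ => ?_
  simp [e, LinearMap.sum_apply]

/-- Extension of equivariant maps into a representation satisfying the trace criterion. The source
may be defined over a subfield. -/
theorem HasTraceOne.exists_extension {a E N : Type*} [Field a] [Algebra a k] [Module a V]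
    [IsScalarTower a k V] {ρ : Representation k G V} (h : HasTraceOne ρ)
    [AddCommGroup E] [Module a E] [AddCommGroup N] [Module a N]
    (σ : Representation a G E) (τ : Representation a G N) (i : N →ₗ[a] E)
    (hi : ∀ g x, i (τ g x) = σ g (i x)) (hinj : Function.Injective i)
    (f : N →ₗ[a] V) (hf : ∀ g x, f (τ g x) = ρ g (f x)) :
    ∃ F : E →ₗ[a] V, (∀ g x, F (σ g x) = ρ g (F x)) ∧ ∀ x, F (i x) = f x := by
  obtain ⟨θ, hθ⟩ := h
  obtain ⟨s, hs⟩ := i.exists_leftInverse_of_injective (LinearMap.ker_eq_bot.2 hinj)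
  have hs' : ∀ x, s (i x) = x := fun x => LinearMap.congr_fun hs x
  -- A linear extension `f ∘ s` is averaged over `G` with `θ` inserted. On the image of `i`
  -- equivariance of `f` leaves the trace of `θ`, which is the identity.
  refine ⟨∑ g, (ρ g).restrictScalars a ∘ₗ θ.restrictScalars a ∘ₗ f ∘ₗ s ∘ₗ σ g⁻¹,
    fun g x => ?_, fun x => ?_⟩
  · simp only [LinearMap.sum_apply, LinearMap.comp_apply, LinearMap.restrictScalars_apply,
      map_sum]
    rw [← Equiv.sum_comp (Equiv.mulLeft g)]
    refine Finset.sum_congr rfl fun b _ => ?_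
    simp only [Equiv.coe_mulLeft, mul_inv_rev, map_mul, Module.End.mul_apply]
    rw [← Module.End.mul_apply (σ g⁻¹), ← map_mul, inv_mul_cancel, map_one, Module.End.one_apply]
  · simp only [LinearMap.sum_apply, LinearMap.comp_apply, LinearMap.restrictScalars_apply]
    simp only [← hi, hs', hf]
    exact hθ _

theorem HasTraceOne.exists_retraction {ρ : Representation k G V} (h : HasTraceOne ρ)
    (σ : Representation k G W) (i : V →ₗ[k] W) (hi : ∀ g x, i (ρ g x) = σ g (i x))
    (hinj : Function.Injective i) :
    ∃ q : W →ₗ[k] V, (∀ g x, q (σ g x) = ρ g (q x)) ∧ ∀ x, q (i x) = x :=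
  h.exists_extension σ ρ i hi hinj LinearMap.id (fun _ _ => rfl)

theorem HasTraceOne.exists_section {ρ : Representation k G V} (h : HasTraceOne ρ)
    (σ : Representation k G W) (q : W →ₗ[k] V) (hq : ∀ g x, q (σ g x) = ρ g (q x))
    (hsurj : Function.Surjective q) :
    ∃ i : V →ₗ[k] W, (∀ g x, i (ρ g x) = σ g (i x)) ∧ ∀ x, q (i x) = x := by
  obtain ⟨θ, hθ⟩ := h
  obtain ⟨s, hs⟩ := q.exists_rightInverse_of_surjective (LinearMap.range_eq_top.2 hsurj)
  have hs' : ∀ x, q (s x) = x := fun x => LinearMap.congr_fun hs x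
  refine ⟨∑ g, σ g ∘ₗ s ∘ₗ θ ∘ₗ ρ g⁻¹, fun g x => ?_, fun x => ?_⟩
  · simp only [LinearMap.sum_apply, LinearMap.comp_apply, map_sum]
    rw [← Equiv.sum_comp (Equiv.mulLeft g)]
    refine Finset.sum_congr rfl fun b _ => ?_
    simp only [Equiv.coe_mulLeft, mul_inv_rev, map_mul, Module.End.mul_apply]
    rw [← Module.End.mul_apply (ρ g⁻¹), ← map_mul, inv_mul_cancel, map_one, Module.End.one_apply]
  · simp only [LinearMap.sum_apply, LinearMap.comp_apply, map_sum, hq, hs']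
    exact hθ _

theorem projective_iff_hasTraceOne' {M : Type*} [AddCommGroup M] [Module k M] [Module k[G] M]
    [IsScalarTower k k[G] M] :
    Module.Projective k[G] M ↔ HasTraceOne (ofModule' M : Representation k G M) := by
  constructor
  · rintro ⟨s, hs⟩
    refine (hasTraceOne_regular.finsupp (ι := M)).of_retract
      (s.restrictScalars k) ((Finsupp.linearCombination k[G] id).restrictScalars k)
      (map_ofModule' s) (map_ofModule' _) hs
  · intro h
    let q : (M →₀ k[G]) →ₗ[k[G]] M := Finsupp.linearCombination k[G] id
    obtain ⟨i, hi, hqi⟩ := h.exists_section (ofModule' (M →₀ k[G]) : Representation k G _)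
      (q.restrictScalars k) (map_ofModule' q)
      (Finsupp.linearCombination_id_surjective k[G] M)
    exact Module.Projective.of_split (moduleHom i hi) q (by ext x; exact hqi x)

theorem projective_iff_hasTraceOne (ρ : Representation k G V) :
    Module.Projective k[G] ρ.asModule ↔ HasTraceOne ρ := by
  rw [projective_iff_hasTraceOne' (k := k)]
  constructor <;> intro h
  · refine h.of_retract ρ.asModuleEquiv.symm.toLinearMap ρ.asModuleEquiv.toLinearMap
      (fun g x => ?_) ρ.asModuleEquiv_ofModule' (fun x => rfl)
    exact ρ.asModuleEquiv.injective
      (ρ.asModuleEquiv_ofModule' g (ρ.asModuleEquiv.symm x)).symm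
  · refine h.of_retract ρ.asModuleEquiv.toLinearMap ρ.asModuleEquiv.symm.toLinearMap
      ρ.asModuleEquiv_ofModule' (fun g x => ?_) (fun x => rfl)
    exact ρ.asModuleEquiv.injective
      (ρ.asModuleEquiv_ofModule' g (ρ.asModuleEquiv.symm x)).symm

end General

end Representation

/-! ### Injective hulls of simple modules -/

namespace Representation

section Hull

variable {k G : Type*} [Field k] [Group G] [Fintype G]
  {M : Type*} [AddCommGroup M] [Module k M] [Module k[G] M] [IsScalarTower k k[G] M]

theorem HasTraceOne.of_isCompl (h : HasTraceOne (ofModule' M : Representation k G M))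
    {A B : Submodule k[G] M} (hAB : IsCompl A B) :
    HasTraceOne (ofModule' A : Representation k G A) :=
  h.of_retract (A.subtype.restrictScalars k) ((A.projectionOnto B hAB).restrictScalars k)
    (map_ofModule' A.subtype) (map_ofModule' (A.projectionOnto B hAB))
    (fun x => Submodule.projectionOnto_apply_left hAB x)

theorem HasTraceOne.of_linearEquiv (h : HasTraceOne (ofModule' M : Representation k G M))
    {N : Type*} [AddCommGroup N] [Module k N] [Module k[G] N] [IsScalarTower k k[G] N]
    (e : M ≃ₗ[k[G]] N) : HasTraceOne (ofModule' N : Representation k G N) :=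
  h.of_retract (e.symm.toLinearMap.restrictScalars k) (e.toLinearMap.restrictScalars k)
    (map_ofModule' e.symm.toLinearMap) (map_ofModule' e.toLinearMap) e.apply_symm_apply

/-- Among the projective submodules containing `V`, one of least dimension works. If a nonzero `T`
missed `V`, an endomorphism fixing `V` and killing `T` would, by Fitting's lemma, split off a
smaller projective submodule containing `V`. -/
theorem HasTraceOne.exists_hull_le [Module.Finite k M]
    (hM : HasTraceOne (ofModule' M : Representation k G M)) (V : Submodule k[G] M)
    [IsSimpleModule k[G] V] :
    ∃ E : Submodule k[G] M, V ≤ E ∧ HasTraceOne (ofModule' E : Representation k G E) ∧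
      ∀ T ≤ E, T ≠ ⊥ → V ≤ T := by
  let P : ℕ → Prop := fun n => ∃ E : Submodule k[G] M, V ≤ E ∧
    HasTraceOne (ofModule' E : Representation k G E) ∧ Module.finrank k E = n
  have hP : ∃ n, P n := ⟨_, ⊤, le_top, hM.of_linearEquiv Submodule.topEquiv.symm, rfl⟩
  classical
  obtain ⟨E, hVE, hE, hn⟩ := Nat.find_spec hP
  refine ⟨E, hVE, hE, fun T hTE hT => ?_⟩
  by_contra hVT
  have hdisj : Disjoint V T := by
    rw [disjoint_iff]
    rcases (isSimpleModule_iff_isAtom.1 ‹IsSimpleModule k[G] V›).le_iff.1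
      (inf_le_left : V ⊓ T ≤ V) with h | h
    · exact h
    · exact absurd (inf_eq_left.1 h) hVT
  let i : (V × T) →ₗ[k[G]] E :=
    (Submodule.inclusion hVE).coprod (Submodule.inclusion hTE)
  have hi : Function.Injective i := by
    rw [← LinearMap.ker_eq_bot, LinearMap.ker_eq_bot']
    rintro ⟨v, t⟩ h
    have h1 : (v : M) + t = 0 := congrArg Subtype.val h
    have h2 : (v : M) ∈ V ⊓ T := ⟨v.2, by rw [eq_neg_of_add_eq_zero_left h1]; exact T.neg_mem t.2⟩
    rw [hdisj.eq_bot, Submodule.mem_bot] at h2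
    rw [h2, zero_add] at h1
    exact Prod.ext (Subtype.ext h2) (Subtype.ext h1)
  -- The map that is the identity on `V` and zero on `T` extends to `E`, since projective modules
  -- have the extension property.
  let f : (V × T) →ₗ[k[G]] E := (Submodule.inclusion hVE).comp (LinearMap.fst _ _ _)
  obtain ⟨F₀, hF₀, hF₀i⟩ := hE.exists_extension (ofModule' E : Representation k G E)
    (ofModule' (V × T)) (i.restrictScalars k) (map_ofModule' i) hi (f.restrictScalars k)
    (map_ofModule' f)
  let F : Module.End k[G] E := moduleHom F₀ hF₀
  have hFV : ∀ v : V, F (Submodule.inclusion hVE v) = Submodule.inclusion hVE v := fun v => by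
    have := hF₀i (v, 0)
    simpa [i, f, F] using this
  have hFT : ∀ t : T, F (Submodule.inclusion hTE t) = 0 := fun t => by
    have := hF₀i (0, t)
    simpa [i, f, F] using this
  have : Module.Finite k E := inferInstanceAs (Module.Finite k (E.restrictScalars k))
  have : IsNoetherian k[G] E := isNoetherian_of_tower k inferInstance
  have : IsArtinian k[G] E := isArtinian_of_tower k inferInstance
  -- The condition `1 ≤ n` is needed for `F ^ n` to kill `T`.
  obtain ⟨n, hn', hn1⟩ := ((LinearMap.eventually_isCompl_ker_pow_range_pow F).and
    (Filter.eventually_ge_atTop 1)).exists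
  have hFV' : ∀ v : V, (F ^ n) (Submodule.inclusion hVE v) = Submodule.inclusion hVE v := by
    intro v
    rw [Module.End.pow_apply]
    exact Function.iterate_fixed (hFV v) n
  have hE' := (hE.of_isCompl hn'.symm).of_linearEquiv
    ((LinearMap.range (F ^ n)).equivMapOfInjective E.subtype E.injective_subtype)
  refine Nat.find_min hP (m := Module.finrank k ((LinearMap.range (F ^ n)).map E.subtype)) ?_
    ⟨_, fun v hv => Submodule.mem_map.2 ⟨_, LinearMap.mem_range.2 ⟨_, hFV' ⟨v, hv⟩⟩, rfl⟩, hE', rfl⟩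
  rw [← hn]
  have h1 : Module.finrank k ((LinearMap.range (F ^ n)).map E.subtype) =
      Module.finrank k (LinearMap.range (F ^ n)) :=
    (((LinearMap.range (F ^ n)).equivMapOfInjective E.subtype
      E.injective_subtype).restrictScalars k).finrank_eq.symm
  rw [h1]
  refine Submodule.finrank_lt (s := (LinearMap.range (F ^ n)).restrictScalars k) (fun htop => hT ?_)
  have htop' : LinearMap.range (F ^ n) = ⊤ := by
    simpa using htop
  have hker : LinearMap.ker (F ^ n) = ⊥ := by
    simpa [htop'] using hn'.inf_eq_bot
  rw [Submodule.eq_bot_iff]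
  intro t ht
  have h2 : Submodule.inclusion hTE ⟨t, ht⟩ ∈ LinearMap.ker (F ^ n) := by
    rw [LinearMap.mem_ker]
    obtain ⟨l, rfl⟩ := Nat.exists_eq_add_of_le' hn1
    rw [pow_succ, Module.End.mul_apply, hFT, map_zero]
  rw [hker, Submodule.mem_bot] at h2
  exact congrArg Subtype.val h2

/-- Frobenius reciprocity: a linear form `l` with `l v ≠ 0` induces the equivariant map sending `x`
to the sum of the `l (g⁻¹ x) g`. It is nonzero, hence injective on a simple module. -/
theorem exists_injective_regular (V : Type*) [AddCommGroup V] [Module k V] [Module k[G] V]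
    [IsScalarTower k k[G] V] [IsSimpleModule k[G] V] :
    ∃ f : V →ₗ[k[G]] k[G], Function.Injective f := by
  have := IsSimpleModule.nontrivial k[G] V
  obtain ⟨v, hv⟩ := exists_ne (0 : V)
  obtain ⟨l, hl⟩ : ∃ l : Module.Dual k V, l v ≠ 0 := by
    by_contra! h
    exact hv ((Module.forall_dual_apply_eq_zero_iff k v).1 h)
  let f₀ : V →ₗ[k] k[G] := ∑ g : G, MonoidAlgebra.lsingle g ∘ₗ l ∘ₗ
    (ofModule' V : Representation k G V) g⁻¹
  have hf₀ : ∀ x, f₀ x = ∑ g : G, MonoidAlgebra.single g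
      (l ((ofModule' V : Representation k G V) g⁻¹ x)) := fun x => by
    simp [f₀, LinearMap.sum_apply]
  let f : V →ₗ[k[G]] k[G] := moduleHom f₀ fun g x => by
    rw [hf₀, hf₀, ← Equiv.sum_comp (Equiv.mulLeft g), map_sum]
    refine Finset.sum_congr rfl fun b _ => ?_
    rw [ofModule'_apply (M := k[G]), smul_eq_mul, MonoidAlgebra.single_mul_single, one_mul,
      Equiv.coe_mulLeft, mul_inv_rev, map_mul, Module.End.mul_apply,
      ← Module.End.mul_apply (ofModule' V g⁻¹), ← map_mul, inv_mul_cancel, map_one,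
      Module.End.one_apply]
  refine ⟨f, (LinearMap.injective_or_eq_zero f).resolve_right fun h => hl ?_⟩
  have h1 : (f₀ v).coeff 1 = 0 := by
    have : f v = 0 := by rw [h, LinearMap.zero_apply]
    exact congrArg (fun z : k[G] => z.coeff 1) this
  classical
  rw [hf₀] at h1
  simpa [Finsupp.single_apply] using h1

theorem exists_hull (V : Type*) [AddCommGroup V] [Module k V] [Module k[G] V]
    [IsScalarTower k k[G] V] [IsSimpleModule k[G] V] :
    ∃ E : Submodule k[G] k[G], HasTraceOne (ofModule' E : Representation k G E) ∧
      ∃ i : V →ₗ[k[G]] E, Function.Injective i ∧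
        ∀ T : Submodule k[G] E, T ≠ ⊥ → LinearMap.range i ≤ T := by
  obtain ⟨f, hf⟩ := exists_injective_regular (k := k) (G := G) V
  have : IsSimpleModule k[G] (LinearMap.range f) :=
    IsSimpleModule.congr (LinearEquiv.ofInjective f hf).symm
  obtain ⟨E, hVE, hE, hT⟩ := (hasTraceOne_regular (k := k) (G := G)).exists_hull_le
    (LinearMap.range f)
  refine ⟨E, hE, f.codRestrict E fun v => hVE ⟨v, rfl⟩, ?_, fun T hT0 => ?_⟩
  · exact fun x y h => hf (congrArg Subtype.val h)
  · have h1 := hT (T.map E.subtype) (Submodule.map_subtype_le E T) (by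
      intro h
      exact hT0 (Submodule.map_injective_of_injective E.injective_subtype (h.trans
        (Submodule.map_bot _).symm)))
    rintro _ ⟨v, rfl⟩
    obtain ⟨t, ht, hte⟩ := h1 ⟨v, rfl⟩
    have : t = f.codRestrict E (fun v => hVE ⟨v, rfl⟩) v := Subtype.ext hte
    exact this ▸ ht

end Hull

end Representation

/-! ### Projective modules of `p`-groups are free -/

theorem LinearMap.coprod_ker_bijective {R M N : Type*} [Ring R] [AddCommGroup M] [Module R M]
    [AddCommGroup N] [Module R N] (f : N →ₗ[R] M) (q : M →ₗ[R] N) (h : ∀ x, q (f x) = x) :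
    Function.Bijective (f.coprod (LinearMap.ker q).subtype) := by
  constructor
  · rw [← LinearMap.ker_eq_bot, LinearMap.ker_eq_bot']
    rintro ⟨x, y, hy⟩ hxy
    simp only [LinearMap.coprod_apply, Submodule.subtype_apply] at hxy
    have hx : x = 0 := by
      have := congrArg q hxy
      rwa [map_add, h, LinearMap.mem_ker.1 hy, add_zero, map_zero] at this
    subst hx
    rw [map_zero, zero_add] at hxy
    subst hxy
    rfl
  · intro x
    refine ⟨(q x, ⟨x - f (q x), ?_⟩), ?_⟩
    · rw [LinearMap.mem_ker, map_sub, h, sub_self]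
    · simp

namespace Representation

section Ker

variable {k G : Type*} [Field k] [Group G] [Fintype G]
  {M N : Type*} [AddCommGroup M] [Module k M] [Module k[G] M] [IsScalarTower k k[G] M]
  [AddCommGroup N] [Module k[G] N]

theorem HasTraceOne.ker (h : HasTraceOne (ofModule' M : Representation k G M))
    (f : N →ₗ[k[G]] M) (q : M →ₗ[k[G]] N) (hqf : ∀ x, q (f x) = x) :
    HasTraceOne (ofModule' (LinearMap.ker q) : Representation k G (LinearMap.ker q)) := by
  let π : M →ₗ[k[G]] LinearMap.ker q := (LinearMap.id - f ∘ₗ q).codRestrict _ fun x => by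
    simp [hqf]
  refine h.of_retract ((LinearMap.ker q).subtype.restrictScalars k) (π.restrictScalars k)
    (map_ofModule' _) (map_ofModule' π) fun x => Subtype.ext ?_
  simp [π]

end Ker

section PGroup

variable {p : ℕ} [Fact p.Prime] {G : Type*} [Group G]

/-- The orbit of a nonzero vector spans a finite space of order divisible by `p`; the number of
fixed points is then divisible by `p`, and `0` is one of them. -/
theorem exists_fixed_ne_zero_zmod [Finite G] (hG : IsPGroup p G) {V : Type*} [AddCommGroup V]
    [Module (ZMod p) V] [Nontrivial V] (ρ : Representation (ZMod p) G V) :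
    ∃ v, v ≠ 0 ∧ ∀ g, ρ g v = v := by
  obtain ⟨v, hv⟩ := exists_ne (0 : V)
  let W : Submodule (ZMod p) V := Submodule.span (ZMod p) (Set.range fun g => ρ g v)
  have hW : ∀ (g : G), ∀ x ∈ W, ρ g x ∈ W := by
    intro g
    have : W ≤ W.comap (ρ g) := by
      refine Submodule.span_le.2 ?_
      rintro _ ⟨h, rfl⟩
      refine Submodule.subset_span ⟨g * h, ?_⟩
      simp
    exact this
  have : Module.Finite (ZMod p) W := Module.Finite.span_of_finite _ (Set.finite_range _)
  have : Finite W := Module.finite_of_finite (ZMod p)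
  let _ : MulAction G W :=
    { smul := fun g x => ⟨ρ g x, hW g x x.2⟩
      one_smul := fun x => Subtype.ext (by change ρ 1 (x : V) = x; simp)
      mul_smul := fun g h x => Subtype.ext (by
        change ρ (g * h) (x : V) = ρ g (ρ h x); simp) }
  have hsmul : ∀ (g : G) (x : W), ((g • x : W) : V) = ρ g x := fun _ _ => rfl
  have hvW : v ∈ W := Submodule.subset_span ⟨1, by simp⟩
  have hdvd : p ∣ Nat.card W := by
    have h1 : addOrderOf (⟨v, hvW⟩ : W) = p := addOrderOf_eq_prime
      (by rw [← Nat.cast_smul_eq_nsmul (ZMod p), CharP.cast_eq_zero, zero_smul])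
      (fun h => hv (congrArg Subtype.val h))
    exact (dvd_of_eq h1.symm).trans (addOrderOf_dvd_natCard (⟨v, hvW⟩ : W))
  obtain ⟨b, hb, hb0⟩ := hG.exists_fixed_point_of_prime_dvd_card_of_fixed_point W hdvd
    (a := 0) (fun g => Subtype.ext (by rw [hsmul]; simp))
  exact ⟨b, fun h => hb0 (Subtype.ext h.symm), fun g => congrArg Subtype.val (hb g)⟩

variable {k : Type*} [Field k] [CharP k p]

theorem exists_fixed_ne_zero [Finite G] (hG : IsPGroup p G) {V : Type*} [AddCommGroup V]
    [Module k V] [Nontrivial V] (ρ : Representation k G V) : ∃ v, v ≠ 0 ∧ ∀ g, ρ g v = v := by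
  have hp : ∀ x : V, p • x = 0 := fun x => by
    rw [← Nat.cast_smul_eq_nsmul k, CharP.cast_eq_zero, zero_smul]
  obtain ⟨_⟩ : Nonempty (Module (ZMod p) V) := ⟨AddCommGroup.zmodModule hp⟩
  let σ : Representation (ZMod p) G V :=
    { toFun := fun g => (ρ g).toAddMonoidHom.toZModLinearMap p
      map_one' := by ext; simp
      map_mul' := fun g h => by ext; simp }
  exact exists_fixed_ne_zero_zmod hG σ

variable [Fintype G]

/-- A fixed vector of the regular module has constant coefficients, so the norm element spans the
fixed vectors. -/
theorem sum_single_mem (hG : IsPGroup p G) (T : Submodule k[G] k[G]) (hT : T ≠ ⊥) :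
    ∑ g : G, MonoidAlgebra.single g (1 : k) ∈ T := by
  have : Nontrivial T := Submodule.nontrivial_iff_ne_bot.2 hT
  obtain ⟨⟨x, hxT⟩, hx0, hx⟩ := exists_fixed_ne_zero hG (ofModule' T : Representation k G T)
  have hx' : ∀ g : G, MonoidAlgebra.single g (1 : k) * x = x := fun g => by
    have := hx g
    rw [ofModule'_apply] at this
    exact congrArg Subtype.val this
  have hc : ∀ g, x.coeff g = x.coeff 1 := fun g => by
    have := congrArg (fun z : k[G] => z.coeff g) (hx' g)
    simpa using this.symm
  have hxs : x = x.coeff 1 • ∑ g : G, MonoidAlgebra.single g (1 : k) := by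
    classical
    ext g
    rw [hc g]
    simp [Finsupp.single_apply]
  have h0 : x.coeff 1 ≠ 0 := by
    intro h
    rw [h, zero_smul] at hxs
    exact hx0 (Subtype.ext hxs)
  have h1 := T.smul_of_tower_mem (x.coeff 1)⁻¹ hxT
  rw [hxs] at h1
  rwa [smul_smul, ← hxs, inv_mul_cancel₀ h0, one_smul] at h1

variable {M : Type*} [AddCommGroup M] [Module k M] [Module k[G] M] [IsScalarTower k k[G] M]

/-- For a fixed vector `v ≠ 0`, the norm element maps `θ v` to the trace of `θ` at `v`, which is
`v`. A nonzero kernel of `x ↦ x • θ v` would contain the norm element. -/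
theorem HasTraceOne.exists_regular_injective (hG : IsPGroup p G) [Nontrivial M]
    (h : HasTraceOne (ofModule' M : Representation k G M)) :
    ∃ f : k[G] →ₗ[k[G]] M, Function.Injective f := by
  obtain ⟨v, hv, hfix⟩ := exists_fixed_ne_zero hG (ofModule' M : Representation k G M)
  obtain ⟨θ, hθ⟩ := h
  refine ⟨LinearMap.toSpanSingleton k[G] M (θ v), LinearMap.ker_eq_bot.1 ?_⟩
  by_contra hker
  have h1 := sum_single_mem hG _ hker
  rw [LinearMap.mem_ker, LinearMap.toSpanSingleton_apply, Finset.sum_smul] at h1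
  refine hv ?_
  rw [← hθ v, ← h1]
  simp only [hfix, ofModule'_apply]

/-- A finite-dimensional projective module over a `p`-group in characteristic `p` is free. -/
theorem HasTraceOne.exists_equiv_fun (hG : IsPGroup p G) [Module.Finite k M]
    (h : HasTraceOne (ofModule' M : Representation k G M)) :
    ∃ n : ℕ, Nonempty (M ≃ₗ[k[G]] (Fin n → k[G])) := by
  induction hd : Module.finrank k M using Nat.strong_induction_on generalizing M with
  | _ d ih =>
    rcases subsingleton_or_nontrivial M with hM | hM
    · exact ⟨0, ⟨LinearEquiv.ofSubsingleton _ _⟩⟩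
    -- A copy of `k[G]` embeds, and it splits off because the regular module is injective relative
    -- to `k`; the complement is again projective.
    · obtain ⟨f, hf⟩ := h.exists_regular_injective hG
      obtain ⟨q₀, hq, hqf⟩ := (hasTraceOne_regular (k := k) (G := G)).exists_retraction
        (ofModule' M : Representation k G M) (f.restrictScalars k) (map_ofModule' f) hf
      let q : M →ₗ[k[G]] k[G] := moduleHom q₀ hq
      have hqf' : ∀ x, q (f x) = x := hqf
      have : Module.Finite k (LinearMap.ker q) :=
        inferInstanceAs (Module.Finite k ((LinearMap.ker q).restrictScalars k))
      have hlt : Module.finrank k (LinearMap.ker q) < d := by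
        rw [← hd]
        refine Submodule.finrank_lt (s := (LinearMap.ker q).restrictScalars k) fun htop => ?_
        have : f 1 ∈ (LinearMap.ker q).restrictScalars k := htop ▸ Submodule.mem_top
        have h1 : q (f 1) = 0 := this
        rw [hqf'] at h1
        exact one_ne_zero h1
      obtain ⟨n, ⟨e⟩⟩ := ih _ hlt (h.ker f q hqf') rfl
      exact ⟨n + 1, ⟨(LinearEquiv.ofBijective _
        (LinearMap.coprod_ker_bijective f q hqf')).symm.trans
          (((LinearEquiv.refl _ _).prodCongr e).trans
            (Fin.consLinearEquiv k[G] fun _ : Fin (n + 1) => k[G]))⟩⟩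

/-- Projective representations of equal dimension of a `p`-group in characteristic `p` are
isomorphic. -/
theorem HasTraceOne.exists_equiv (hG : IsPGroup p G) {V W : Type*} [AddCommGroup V] [Module k V]
    [AddCommGroup W] [Module k W] [Module.Finite k V] [Module.Finite k W]
    {ρ : Representation k G V} {σ : Representation k G W} (h : HasTraceOne ρ) (h' : HasTraceOne σ)
    (hd : Module.finrank k V = Module.finrank k W) :
    ∃ e : V ≃ₗ[k] W, ∀ g x, e (ρ g x) = σ g (e x) := by
  rw [← projective_iff_hasTraceOne, projective_iff_hasTraceOne' (k := k)] at h h'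
  obtain ⟨n, ⟨e⟩⟩ := h.exists_equiv_fun hG
  obtain ⟨m, ⟨f⟩⟩ := h'.exists_equiv_fun hG
  have hnm : n = m := by
    have h1 := (e.restrictScalars k).finrank_eq
    have h2 := (f.restrictScalars k).finrank_eq
    have h3 : Module.finrank k ρ.asModule = Module.finrank k σ.asModule := hd
    rw [h1, h2, Module.finrank_pi_fintype, Module.finrank_pi_fintype] at h3
    have h4 : 0 < Module.finrank k k[G] := Module.finrank_pos
    simp only [Finset.sum_const, Finset.card_univ, Fintype.card_fin, smul_eq_mul] at h3
    exact Nat.eq_of_mul_eq_mul_right h4 h3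
  subst hnm
  let c := e.trans f.symm
  refine ⟨ρ.asModuleEquiv.symm.trans ((c.restrictScalars k).trans σ.asModuleEquiv),
    fun g x => ?_⟩
  have h1 := map_ofModule' c.toLinearMap g (ρ.asModuleEquiv.symm x)
  have h2 := congrArg σ.asModuleEquiv h1
  rw [asModuleEquiv_ofModule'] at h2
  refine Eq.trans ?_ h2
  exact congrArg (fun y => σ.asModuleEquiv (c y)) (ρ.asModuleEquiv.injective
    (ρ.asModuleEquiv_ofModule' g (ρ.asModuleEquiv.symm x)).symm)

end PGroup

end Representation

/-! ### Simple modules under extension of scalars -/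

-- The coefficients of a monic factor over `k` are integral over `a`, hence lie in `a`; a
-- factorization over `k` is one over `a`.
open Polynomial in
theorem Polynomial.Monic.irreducible_map_of_isIntegral_mem_range {a k : Type*} [Field a] [Field k]
    [Algebra a k] (hcl : ∀ x : k, IsIntegral a x → x ∈ (algebraMap a k).range) {f : a[X]}
    (hf : f.Monic) (hirr : Irreducible f) : Irreducible (f.map (algebraMap a k)) := by
  have hinj := Polynomial.map_injective (algebraMap a k) (algebraMap a k).injective
  have hlift : ∀ g : k[X], g.Monic → g ∣ f.map (algebraMap a k) →
      ∃ g₀ : a[X], g₀.Monic ∧ g₀.map (algebraMap a k) = g := by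
    intro g hg hd
    have h1 := integralClosure.mem_lifts_of_monic_of_dvd_map k hf hg hd
    rw [lifts_iff_coeff_lifts] at h1
    have h2 : g ∈ lifts (algebraMap a k) := by
      rw [lifts_iff_coeff_lifts]
      intro n
      obtain ⟨y, hy⟩ := h1 n
      rw [← hy]
      exact hcl _ y.2
    obtain ⟨g₀, hg₀, -, hm⟩ := lifts_and_natDegree_eq_and_monic h2 hg
    exact ⟨g₀, hm, hg₀⟩
  have h1 : f.map (algebraMap a k) ≠ 1 := by
    intro h
    rw [← Polynomial.map_one (algebraMap a k)] at h
    exact hirr.ne_one (hinj h)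
  rw [irreducible_of_monic (hf.map _) h1]
  intro g h hg hh hgh
  obtain ⟨g₀, hg₀, rfl⟩ := hlift g hg ⟨h, hgh.symm⟩
  obtain ⟨h₀, hh₀, rfl⟩ := hlift h hh ⟨_, (mul_comm _ _).trans hgh |>.symm⟩
  rw [← Polynomial.map_mul] at hgh
  have h2 := hinj hgh
  have h3 := (irreducible_of_monic hf hirr.ne_one).1 hirr g₀ h₀ hg₀ hh₀ h2
  rcases h3 with h | h
  · left; rw [h, Polynomial.map_one]
  · right; rw [h, Polynomial.map_one]

/-- Finitely many endomorphisms of a finite-dimensional space over an algebraic extension of a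
finite field lie in a finite ring of endomorphisms. -/
theorem Module.End.exists_finite_subring {p : ℕ} [Fact p.Prime] {a V : Type*} [Field a]
    [Algebra (ZMod p) a] [Algebra.IsAlgebraic (ZMod p) a] [AddCommGroup V] [Module a V]
    [Module.Finite a V] (T : Set (Module.End a V)) (hT : T.Finite) :
    ∃ R : Subring (Module.End a V), T ⊆ R ∧ Finite R := by
  let b := Module.finBasis a V
  let e := LinearMap.toMatrixAlgEquiv b
  let E : Set a := ⋃ t ∈ T, Set.range fun z : Fin _ × Fin _ => e t z.1 z.2
  have hE : E.Finite := hT.biUnion fun t _ => Set.finite_range _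
  have hfg := fg_adjoin_of_finite (R := ZMod p) hE fun x _ => Algebra.IsIntegral.isIntegral x
  have : Module.Finite (ZMod p) (Algebra.adjoin (ZMod p) E) := ⟨(Submodule.fg_top _).2 hfg⟩
  have hfin : Finite (Algebra.adjoin (ZMod p) E) := Module.finite_of_finite (ZMod p)
  refine ⟨((Algebra.adjoin (ZMod p) E).matrix (n := Fin _)).toSubring.comap
    e.toRingEquiv.toRingHom, fun t ht => ?_, ?_⟩
  · intro i j
    exact Algebra.subset_adjoin (Set.mem_biUnion ht ⟨(i, j), rfl⟩)
  · refine _root_.Finite.of_injective (β := Fin _ → Fin _ → Algebra.adjoin (ZMod p) E)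
      (fun f i j => ⟨e f i j, f.2 i j⟩) fun f g hfg => Subtype.ext (e.injective ?_)
    ext i j
    exact congrArg Subtype.val (congrFun (congrFun hfg i) j)

/-- Wedderburn's theorem, together with the cyclicity of the unit group of a finite field. -/
theorem Finite.exists_forall_eq_zero_or_pow (R : Type*) [Ring R] [IsDomain R] [Finite R] :
    ∃ α : R, α ≠ 0 ∧ ∀ x, x = 0 ∨ ∃ n : ℕ, x = α ^ n := by
  have hF := Finite.isDomain_to_isField R
  have hcomm : ∀ x y : R, x * y = y * x := hF.mul_comm
  have : IsCyclic Rˣ := by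
    let F : Field R := hF.toField
    exact (inferInstance : IsCyclic (@Units R F.toDivisionRing.toMonoid))
  obtain ⟨α, hα⟩ := IsCyclic.exists_generator (α := Rˣ)
  refine ⟨α, α.ne_zero, fun x => or_iff_not_imp_left.2 fun hx => ?_⟩
  obtain ⟨y, hy⟩ := hF.mul_inv_cancel hx
  obtain ⟨n, hn⟩ := mem_powers_iff_mem_zpowers.2 (hα ⟨x, y, hy, (hcomm _ _).trans hy⟩)
  exact ⟨n, by simpa using congrArg Units.val hn.symm⟩

open Polynomial in
/-- The endomorphism ring of a simple module, finite-dimensional over `a`, stays a field under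
extension of scalars to a field in which `a` is algebraically closed. -/
theorem IsSimpleModule.eq_zero_of_sum_smul_eq_zero
    (p : ℕ) [Fact p.Prime] {a k : Type*} [Field a] [Field k] [Algebra a k]
    [Algebra (ZMod p) a] [Algebra.IsAlgebraic (ZMod p) a]
    (hcl : ∀ x : k, IsIntegral a x → x ∈ (algebraMap a k).range)
    {A S X : Type*} [Ring A] [Algebra a A] [AddCommGroup S] [Module a S] [Module A S]
    [IsScalarTower a A S] [IsSimpleModule A S] [Module.Finite a S] [AddCommGroup X] [Module k X]
    [Module a X] [IsScalarTower a k X] (f : S →ₗ[a] X) (hf : f ≠ 0) {ι : Type*} (s : Finset ι)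
    (c : ι → k) (hc : LinearIndependent a c) (δ : ι → Module.End A S)
    (h : ∀ x, ∑ i ∈ s, c i • f (δ i x) = 0) : ∀ i ∈ s, δ i = 0 := by
  classical
  let ρ : Module.End A S →+* Module.End a S :=
    { toFun := fun g => g.restrictScalars a
      map_one' := rfl
      map_mul' := fun _ _ => rfl
      map_zero' := rfl
      map_add' := fun _ _ => rfl }
  have hρ : Function.Injective ρ := fun g g' hg => by
    ext x; exact LinearMap.congr_fun hg x
  obtain ⟨R₀, hR₀, hfin⟩ := Module.End.exists_finite_subring (p := p)
    ((fun i => ρ (δ i)) '' s) (s.finite_toSet.image _)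
  -- By Schur's lemma this finite ring is a domain, hence a field; all the `δ i` become polynomials
  -- in a single generator `α`.
  let R : Subring (Module.End A S) := R₀.comap ρ
  have hδR : ∀ i ∈ s, δ i ∈ R := fun i hi => hR₀ ⟨i, hi, rfl⟩
  have : Finite R := Finite.of_injective (fun x : R => (⟨ρ x, x.2⟩ : R₀)) fun x y hxy =>
    Subtype.ext (hρ (congrArg Subtype.val hxy))
  obtain ⟨⟨α, hαR⟩, hα0, hα⟩ := Finite.exists_forall_eq_zero_or_pow R
  have hα0' : α ≠ 0 := fun h => hα0 (Subtype.ext h)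
  have hδα : ∀ i ∈ s, δ i = 0 ∨ ∃ n : ℕ, δ i = α ^ n := fun i hi => by
    rcases hα ⟨δ i, hδR i hi⟩ with h | ⟨n, h⟩
    · exact Or.inl (congrArg Subtype.val h)
    · exact Or.inr ⟨n, by simpa using congrArg Subtype.val h⟩
  have hint : IsIntegral a α := by
    have hfin : Module.Finite a (Module.End A S) :=
      Module.Finite.of_injective (LinearMap.restrictScalarsₗ a A S S a)
        (LinearMap.restrictScalars_injective a)
    exact Algebra.IsIntegral.isIntegral α
  let μ := minpoly a α
  have hμ := minpoly.monic hint
  have hμk := hμ.irreducible_map_of_isIntegral_mem_range hcl (minpoly.irreducible hint)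
  have hq : ∀ i, ∃ q : a[X], i ∈ s → aeval α q = δ i ∧ q.degree < μ.degree := by
    intro i
    by_cases hi : i ∈ s
    · rcases hδα i hi with h | ⟨n, h⟩
      · exact ⟨0, fun _ => ⟨by rw [map_zero, h], by
          rw [degree_zero]; exact bot_lt_iff_ne_bot.2 (degree_ne_bot.2 hμ.ne_zero)⟩⟩
      · refine ⟨Polynomial.X ^ n %ₘ μ, fun _ => ⟨?_, degree_modByMonic_lt _ hμ⟩⟩
        rw [aeval_modByMonic_eq_self_of_root (minpoly.aeval a α), map_pow, aeval_X, h]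
    · exact ⟨0, fun h => absurd h hi⟩
  choose q hq using hq
  let Q : k[X] := ∑ i ∈ s, C (c i) * (q i).map (algebraMap a k)
  -- `Ψ x` evaluates a polynomial over `k` at `α`, applied to `x` and pushed to `X` by `f`. The
  -- polynomials killed by all `Ψ x` form an ideal containing both `Q` and the minimal polynomial
  -- `μ`.
  let Ψ : S → k[X] →ₗ[k] X := fun x =>
    Polynomial.lsum fun j => LinearMap.toSpanSingleton k X (f ((α ^ j) x))
  have hΨ : ∀ x j t, Ψ x (monomial j t) = t • f ((α ^ j) x) := fun x j t => by
    simp [Ψ, Polynomial.lsum_apply, sum_monomial_index]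
  have hΨmap : ∀ x (g : a[X]), Ψ x (g.map (algebraMap a k)) = f (aeval α g x) := by
    intro x g
    induction g using Polynomial.induction_on' with
    | add g h hg hh => simp only [Polynomial.map_add, map_add, hg, hh, LinearMap.add_apply]
    | monomial j t =>
      rw [map_monomial, hΨ, aeval_monomial, algebraMap_smul, ← map_smul]
      rfl
  have hΨmul : ∀ g : k[X], (∀ x, Ψ x g = 0) → ∀ (u : k[X]) x, Ψ x (u * g) = 0 := by
    intro g hg u x
    have hX : ∀ (j : ℕ) (t : k) (h : k[X]), Ψ x (monomial j t * h) = t • Ψ ((α ^ j) x) h := by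
      intro j t h
      induction h using Polynomial.induction_on' with
      | add g h hg hh => simp only [mul_add, map_add, hg, hh, smul_add]
      | monomial l t' =>
        rw [monomial_mul_monomial, hΨ, hΨ, smul_smul, add_comm, pow_add]
        rfl
    induction u using Polynomial.induction_on' with
    | add u v hu hv => rw [add_mul, map_add, hu, hv, add_zero]
    | monomial j t => rw [hX, hg, smul_zero]
  have hΨQ : ∀ x, Ψ x Q = 0 := by
    intro x
    rw [← h x, map_sum]
    refine Finset.sum_congr rfl fun i hi => ?_
    rw [← smul_eq_C_mul, map_smul, hΨmap, (hq i hi).1]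
  have hΨμ : ∀ x, Ψ x (μ.map (algebraMap a k)) = 0 := by
    intro x
    rw [hΨmap, minpoly.aeval, LinearMap.zero_apply, map_zero]
  by_cases hQ : Q = 0
  · intro i hi
    rw [← (hq i hi).1]
    suffices q i = 0 by rw [this, map_zero]
    ext l
    have h1 := congrArg (fun z => z.coeff l) hQ
    simp only [Q, finsetSum_coeff, coeff_C_mul, coeff_map, coeff_zero] at h1
    refine linearIndependent_iff'.1 hc s (fun i => (q i).coeff l) ?_ i hi
    rw [← h1]
    refine Finset.sum_congr rfl fun i _ => ?_
    rw [Algebra.smul_def, mul_comm]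
  -- A nonzero `Q` of degree below that of the irreducible `μ` is coprime to it. The ideal then
  -- contains `1`, forcing `f = 0`.
  · exfalso
    have hdeg : Q.degree < (μ.map (algebraMap a k)).degree := by
      rw [degree_map]
      refine (degree_sum_le _ _).trans_lt ?_
      rw [Finset.sup_lt_iff (bot_lt_iff_ne_bot.2 (degree_ne_bot.2 hμ.ne_zero))]
      intro i hi
      refine lt_of_le_of_lt ?_ (hq i hi).2
      rw [← smul_eq_C_mul]
      exact (degree_smul_le _ _).trans degree_map_le
    have hcop : IsCoprime (μ.map (algebraMap a k)) Q :=
      hμk.coprime_iff_not_dvd.2 fun hd => hQ (eq_zero_of_dvd_of_degree_lt hd hdeg)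
    obtain ⟨u, v, huv⟩ := hcop
    refine hf (LinearMap.ext fun x => ?_)
    have h1 : Ψ x 1 = 0 := by
      rw [← huv, map_add, hΨmul _ hΨμ, hΨmul _ hΨQ, add_zero]
    rw [← monomial_zero_one, hΨ] at h1
    simpa using h1

namespace Representation

/-- Each coordinate of `τ` is zero or an isomorphism onto the simple submodule `j(S)`. Measured
against one nonzero coordinate, all coordinates become endomorphisms of `T`, and the relation `hτM`
is one that linear independence of `c` forbids. -/
theorem false_of_simple_sum_smul_eq_zero (p : ℕ) [Fact p.Prime] {a k : Type*} [Field a]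
    [Field k] [Algebra a k] [Algebra (ZMod p) a] [Algebra.IsAlgebraic (ZMod p) a]
    (hcl : ∀ x : k, IsIntegral a x → x ∈ (algebraMap a k).range) {A : Type*} [Ring A] [Algebra a A]
    {E S X T ι : Type*} [AddCommGroup E] [Module a E] [Module A E] [IsScalarTower a A E]
    [AddCommGroup S] [Module A S] [IsSimpleModule A S]
    [AddCommGroup T] [Module a T] [Module A T] [IsScalarTower a A T] [IsSimpleModule A T]
    [Module.Finite a T]
    [AddCommGroup X] [Module k X] [Module a X] [IsScalarTower a k X] (j : S →ₗ[A] E)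
    (hj : ∀ T : Submodule A E, T ≠ ⊥ → LinearMap.range j ≤ T)
    (f : E →ₗ[a] X) (hfj : Function.Injective fun s => f (j s))
    (c : ι → k) (hc : LinearIndependent a c) (τ : T →ₗ[A] (ι →₀ E)) (hτ : Function.Injective τ)
    (hτM : ∀ t, ((τ t).sum fun i e => c i • f e) = 0) : False := by
  classical
  have := IsSimpleModule.nontrivial A T
  have hjinj : Function.Injective j := fun x y h => hfj (congrArg f h)
  obtain ⟨t₀, ht₀⟩ := exists_ne (0 : T)
  obtain ⟨i₀, hi₀⟩ : ∃ i, τ t₀ i ≠ 0 := by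
    by_contra! h
    exact ht₀ (hτ (by rw [map_zero]; ext i; exact h i))
  let q : ∀ i, T →ₗ[A] E := fun i => Finsupp.lapply i ∘ₗ τ
  have hq : ∀ i t, q i t = τ t i := fun _ _ => rfl
  have hqinj : ∀ i t, t ≠ 0 → q i t ≠ 0 → Function.Injective (q i) := fun i t ht hqt =>
    (LinearMap.injective_or_eq_zero (q i)).resolve_right fun h => hqt (LinearMap.congr_fun h t)
  have hjrange : LinearMap.range j ≠ ⊥ := by
    have := IsSimpleModule.nontrivial A S
    intro h
    obtain ⟨s, hs⟩ := exists_ne (0 : S)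
    refine hs (hjinj ?_)
    rw [map_zero]
    exact (Submodule.mem_bot A).1 (h ▸ LinearMap.mem_range_self j s)
  have hrange : ∀ i, Function.Injective (q i) → LinearMap.range (q i) = LinearMap.range j := by
    intro i hi
    have h1 : LinearMap.range (q i) ≠ ⊥ := by
      intro h
      refine ht₀ (hi ?_)
      rw [map_zero]
      exact (Submodule.mem_bot A).1 (h ▸ LinearMap.mem_range_self (q i) t₀)
    have h2 : IsAtom (LinearMap.range (q i)) := isSimpleModule_iff_isAtom.1
      (IsSimpleModule.congr (LinearEquiv.ofInjective (q i) hi).symm)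
    exact ((h2.le_iff.1 (hj _ h1)).resolve_left hjrange).symm
  have hrange_le : ∀ i t, q i t ∈ LinearMap.range j := by
    intro i t
    rcases LinearMap.injective_or_eq_zero (q i) with h | h
    · exact hrange i h ▸ LinearMap.mem_range_self (q i) t
    · rw [h]; exact Submodule.zero_mem _
  have hinj₀ := hqinj i₀ t₀ ht₀ hi₀
  let e : T ≃ₗ[A] LinearMap.range j :=
    (LinearEquiv.ofInjective (q i₀) hinj₀).trans (LinearEquiv.ofEq _ _ (hrange i₀ hinj₀))
  have he : ∀ t, (e t : E) = q i₀ t := fun _ => rfl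
  let δ : ι → Module.End A T := fun i =>
    e.symm.toLinearMap ∘ₗ (q i).codRestrict (LinearMap.range j) (hrange_le i)
  have hδ : ∀ i t, q i₀ (δ i t) = q i t := by
    intro i t
    rw [← he]
    simp [δ]
  let f' : T →ₗ[a] X := f ∘ₗ (q i₀).restrictScalars a
  have hf' : f' ≠ 0 := by
    intro h
    obtain ⟨s, hs⟩ : q i₀ t₀ ∈ LinearMap.range j := hrange_le i₀ t₀
    have h1 : f (j s) = f (j 0) := by
      rw [hs, map_zero, map_zero]
      exact LinearMap.congr_fun h t₀
    rw [hfj h1, map_zero] at hs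
    exact hi₀ hs.symm
  have key := IsSimpleModule.eq_zero_of_sum_smul_eq_zero p hcl f' hf' (τ t₀).support c
    hc δ (fun t => by
      rw [← hτM t, Finsupp.sum_of_support_subset (s := (τ t₀).support)]
      · refine Finset.sum_congr rfl fun i _ => ?_
        change c i • f (q i₀ (δ i t)) = _
        rw [hδ, hq]
      · intro i hi
        rw [Finsupp.mem_support_iff] at hi ⊢
        intro h0
        have h1 : q i = 0 := (LinearMap.injective_or_eq_zero (q i)).resolve_left fun h =>
          ht₀ (h (by rw [map_zero]; exact h0))
        exact hi (by rw [← hq, h1]; rfl)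
      · intro i _
        rw [map_zero, smul_zero]) i₀ (Finsupp.mem_support_iff.2 hi₀)
  refine hi₀ ?_
  rw [← hq, ← hδ, key, LinearMap.zero_apply, map_zero]

theorem exists_simple_submodule {a G : Type*} [Field a] [Group G] [Finite G] (M : Type*)
    [AddCommGroup M] [Module a M] [Module a[G] M] [IsScalarTower a a[G] M] [Nontrivial M] :
    ∃ T : Submodule a[G] M, IsSimpleModule a[G] T ∧ Module.Finite a T := by
  obtain ⟨x, hx⟩ := exists_ne (0 : M)
  let N := Submodule.span a[G] {x}
  have : Nontrivial N := Submodule.nontrivial_span_singleton hx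
  have : Module.Finite a N := Module.Finite.trans a[G] N
  have : IsArtinian a[G] N := isArtinian_of_tower a inferInstance
  obtain ⟨T, hT⟩ := IsAtomic.exists_atom (Submodule a[G] N)
  rw [← isSimpleModule_iff_isAtom] at hT
  have : Module.Finite a T := inferInstanceAs (Module.Finite a (T.restrictScalars a))
  let e := T.equivMapOfInjective N.subtype N.injective_subtype
  exact ⟨T.map N.subtype, IsSimpleModule.congr (N := T) e.symm,
    Module.Finite.equiv (e.restrictScalars a)⟩

/-- Let `E` be an `a[G]`-module in which every nonzero submodule contains a fixed simple one, and
`f` an equivariant map from `E` to a representation over `k` that is injective on the simple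
submodule. If `a` is algebraically closed in `k`, then the extension of `f` to `k ⊗ E` is
injective. -/
theorem injective_liftBaseChange_of_essential (p : ℕ) [Fact p.Prime] {a k : Type*} [Field a]
    [Field k] [Algebra a k] [Algebra (ZMod p) a] [Algebra.IsAlgebraic (ZMod p) a]
    (hcl : ∀ x : k, IsIntegral a x → x ∈ (algebraMap a k).range) {G : Type*} [Group G] [Finite G]
    {E S X : Type*} [AddCommGroup E] [Module a E] [Module a[G] E] [IsScalarTower a a[G] E]
    [AddCommGroup S] [Module a[G] S] [IsSimpleModule a[G] S]
    [AddCommGroup X] [Module k X] [Module a X] [IsScalarTower a k X] (j : S →ₗ[a[G]] E)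
    (hj : ∀ T : Submodule a[G] E, T ≠ ⊥ → LinearMap.range j ≤ T) (ρ : Representation k G X)
    (f : E →ₗ[a] X) (hf : ∀ g x, f ((ofModule' E : Representation a G E) g x) = ρ g (f x))
    (hfj : Function.Injective fun s => f (j s)) : Function.Injective (f.liftBaseChange k) := by
  classical
  -- A basis of `k` over `a` identifies `k ⊗ E` with a direct sum of copies of `E`. The kernel is an
  -- `a[G]`-submodule there, and if nonzero it contains a simple one.
  let c := Module.Free.chooseBasis a k
  rw [← LinearMap.ker_eq_bot, LinearMap.ker_eq_bot']
  intro z hz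
  let Λ : (Module.Free.ChooseBasisIndex a k →₀ E) →ₗ[a] X :=
    Finsupp.lsum a fun i => c i • f
  have hΛ : ∀ x, Λ x = x.sum fun i e => c i • f e := fun x => rfl
  have hΛsymm : ∀ x, f.liftBaseChange k ((TensorProduct.equivFinsuppOfBasisLeft c).symm x) =
      Λ x := by
    intro x
    rw [TensorProduct.equivFinsuppOfBasisLeft_symm_apply, hΛ, Finsupp.sum, Finsupp.sum, map_sum]
    exact Finset.sum_congr rfl fun i _ => by rw [LinearMap.liftBaseChange_tmul]
  have hΛg : ∀ (g : G) x, Λ (MonoidAlgebra.single g (1 : a) • x) = ρ g (Λ x) := by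
    intro g x
    induction x using Finsupp.induction_linear with
    | zero => simp
    | add x y hx hy => rw [smul_add, map_add, hx, hy, map_add, map_add]
    | single i e =>
      rw [Finsupp.smul_single, hΛ, hΛ, Finsupp.sum_single_index (by simp),
        Finsupp.sum_single_index (by simp), (ρ g).map_smul, ← hf, ofModule'_apply]
  let M₀ : Submodule a[G] (Module.Free.ChooseBasisIndex a k →₀ E) :=
    { (LinearMap.ker Λ) with
      smul_mem' := by
        intro b x hx
        have hx' : Λ x = 0 := hx
        change Λ (b • x) = 0
        induction b using MonoidAlgebra.induction_linear with
        | zero => simp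
        | add b b' hb hb' => rw [add_smul, map_add, hb, hb', add_zero]
        | single g t =>
          have : MonoidAlgebra.single g t = t • MonoidAlgebra.single g (1 : a) := by simp
          rw [this, smul_assoc, map_smul, hΛg, hx', map_zero, smul_zero] }
  by_contra hz0
  let x₀ := TensorProduct.equivFinsuppOfBasisLeft c z
  have hx₀ : x₀ ≠ 0 := by simpa [x₀] using hz0
  have hx₀M : x₀ ∈ M₀ := by
    change Λ x₀ = 0
    rw [← hΛsymm, LinearEquiv.symm_apply_apply, hz]
  have : Nontrivial M₀ := ⟨⟨x₀, hx₀M⟩, 0, fun h => hx₀ (congrArg Subtype.val h)⟩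
  obtain ⟨T, hT, hTfin⟩ := exists_simple_submodule (a := a) (G := G) M₀
  let e := T.equivMapOfInjective M₀.subtype M₀.injective_subtype
  have : IsSimpleModule a[G] (T.map M₀.subtype) := IsSimpleModule.congr (N := T) e.symm
  have : Module.Finite a (T.map M₀.subtype) := Module.Finite.equiv (e.restrictScalars a)
  refine false_of_simple_sum_smul_eq_zero (T := T.map M₀.subtype) p hcl j hj f hfj c
    c.linearIndependent (T.map M₀.subtype).subtype (Submodule.injective_subtype _) ?_
  rintro ⟨_, t, ht, rfl⟩
  exact t.2

end Representation

/-! ### Descent of projective modules to the algebraic closure of the prime field -/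

namespace Representation

section BaseChange

variable {a : Type*} (k : Type*) {G V : Type*} [Field a] [Field k] [Algebra a k] [Group G]
  [AddCommGroup V] [Module a V]

/-- Extension of scalars of a representation. -/
def baseChange (ρ : Representation a G V) : Representation k G (k ⊗[a] V) where
  toFun g := (ρ g).baseChange k
  map_one' := by rw [map_one]; exact LinearMap.baseChange_id
  map_mul' g h := by rw [map_mul]; exact LinearMap.baseChange_comp ..

theorem baseChange_tmul (ρ : Representation a G V) (g : G) (c : k) (x : V) :
    ρ.baseChange k g (c ⊗ₜ x) = c ⊗ₜ ρ g x := rfl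

theorem HasTraceOne.baseChange [Fintype G] {ρ : Representation a G V} (h : HasTraceOne ρ) :
    HasTraceOne (ρ.baseChange k) := by
  obtain ⟨θ, hθ⟩ := h
  refine ⟨θ.baseChange k, fun z => ?_⟩
  induction z using TensorProduct.induction_on with
  | zero => simp
  | add x y hx hy => simp only [map_add, Finset.sum_add_distrib, hx, hy]
  | tmul c x =>
    simp only [baseChange_tmul, LinearMap.baseChange_tmul]
    rw [← TensorProduct.tmul_sum, hθ]

theorem liftBaseChange_equivariant {X : Type*} [AddCommGroup X] [Module k X] [Module a X]
    [IsScalarTower a k X] (σ : Representation a G V) (ρ : Representation k G X) (f : V →ₗ[a] X)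
    (hf : ∀ g x, f (σ g x) = ρ g (f x)) (g : G) (z : k ⊗[a] V) :
    f.liftBaseChange k (σ.baseChange k g z) = ρ g (f.liftBaseChange k z) := by
  induction z using TensorProduct.induction_on with
  | zero => simp
  | add x y hx hy => simp only [map_add, hx, hy]
  | tmul c x =>
    rw [baseChange_tmul, LinearMap.liftBaseChange_tmul, LinearMap.liftBaseChange_tmul, hf,
      map_smul]

variable {k} [Fintype G]

variable (a) in
/-- A representation over `k` arises by extension of scalars from a projective representation
over `a`. -/
def Descends {X : Type*} [AddCommGroup X] [Module k X] [Module a X] [IsScalarTower a k X]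
    (ρ : Representation k G X) : Prop :=
  ∃ (n : ℕ) (σ : Representation a G (Fin n → a)) (f : (Fin n → a) →ₗ[a] X),
    HasTraceOne σ ∧ (∀ g x, f (σ g x) = ρ g (f x)) ∧ IsBaseChange k f

theorem Descends.of_isBaseChange {X : Type*} [AddCommGroup X] [Module k X] [Module a X]
    [IsScalarTower a k X] {ρ : Representation k G X} [Module.Finite a V]
    {σ : Representation a G V} (hσ : HasTraceOne σ) (f : V →ₗ[a] X)
    (hf : ∀ g x, f (σ g x) = ρ g (f x)) (hbc : IsBaseChange k f) : Descends a ρ := by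
  let e := (Module.finBasis a V).equivFun
  let σ' : Representation a G (Fin (Module.finrank a V) → a) :=
    { toFun := fun g => e.conj (σ g)
      map_one' := by rw [map_one]; exact LinearEquiv.conj_id e
      map_mul' := fun g h => by rw [map_mul]; exact LinearEquiv.conj_comp e _ _ }
  have hσ' : ∀ g x, σ' g x = e (σ g (e.symm x)) := fun _ _ => rfl
  refine ⟨_, σ', f ∘ₗ e.symm.toLinearMap, ?_, fun g x => ?_, ?_⟩
  · exact hσ.of_retract e.symm.toLinearMap e.toLinearMap (fun g x => by simp [hσ'])
      (fun g x => by simp [hσ']) (fun x => by simp)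
  · simp [hσ', hf]
  · refine IsBaseChange.of_equiv ((e.symm.baseChange a k _ _).trans hbc.equiv) fun x => ?_
    simp [IsBaseChange.equiv_tmul]

end BaseChange

/-- Projective representations descend to a relatively algebraically closed subfield that is
algebraic over the prime field. -/
theorem HasTraceOne.descends (p : ℕ) [Fact p.Prime] {a k : Type*} [Field a]
    [Field k] [Algebra a k] [Algebra (ZMod p) a] [Algebra.IsAlgebraic (ZMod p) a]
    (hcl : ∀ x : k, IsIntegral a x → x ∈ (algebraMap a k).range) {G : Type*} [Group G] [Fintype G]
    {X : Type*} [AddCommGroup X] [Module k X] [Module a X] [IsScalarTower a k X]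
    [Module.Finite k X] {ρ : Representation k G X} (h : HasTraceOne ρ) : Descends a ρ := by
  induction hd : Module.finrank k X using Nat.strong_induction_on generalizing X with
  | _ d ih =>
    rcases subsingleton_or_nontrivial X with hX | hX
    · refine ⟨0, 1, 0, ⟨0, fun x => Subsingleton.elim _ _⟩, fun g x => Subsingleton.elim _ _, ?_⟩
      exact IsBaseChange.of_equiv (LinearEquiv.ofSubsingleton _ _) fun x => Subsingleton.elim _ _
    -- Over `a` the space `X` may have infinite dimension, but it contains a simple
    -- finite-dimensional `a[G]`-submodule `T`. Its hull `E` maps to `X` by the extension property,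
    -- and `k ⊗ E` embeds as a projective summand. The complement has smaller dimension.
    · let σ : Representation a G X :=
        { toFun := fun g => (ρ g).restrictScalars a
          map_one' := by rw [map_one]; rfl
          map_mul' := fun g g' => by rw [map_mul]; rfl }
      have : Nontrivial σ.asModule := hX
      obtain ⟨T, hT, -⟩ := exists_simple_submodule (a := a) (G := G) σ.asModule
      obtain ⟨E, hE, j, hj, hjE⟩ := exists_hull (k := a) (G := G) T
      let f₀ : T →ₗ[a] X := σ.asModuleEquiv.toLinearMap ∘ₗ T.subtype.restrictScalars a
      have hf₀ : ∀ g x, f₀ ((ofModule' T : Representation a G T) g x) = ρ g (f₀ x) := by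
        intro g x
        have h1 := map_ofModule' T.subtype g x
        exact (congrArg σ.asModuleEquiv h1).trans (σ.asModuleEquiv_ofModule' g _)
      obtain ⟨f, hf, hfj⟩ := h.exists_extension (ofModule' E : Representation a G E)
        (ofModule' T) (j.restrictScalars a) (map_ofModule' j) hj f₀ hf₀
      have hfj' : Function.Injective fun s => f (j s) := by
        intro x y hxy
        have h1 : f₀ x = f₀ y := (hfj x).symm.trans (hxy.trans (hfj y))
        exact Subtype.ext h1
      have hΦ := injective_liftBaseChange_of_essential p hcl j hjE ρ f hf hfj'
      have hΦg := liftBaseChange_equivariant k _ ρ f hf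
      obtain ⟨q, hq, hqf⟩ := (hE.baseChange k).exists_retraction ρ _ hΦg hΦ
      let B : Subrepresentation ρ := ⟨LinearMap.ker q, fun g x hx => by
        rw [LinearMap.mem_ker] at hx ⊢
        rw [hq, hx, map_zero]⟩
      have hB : HasTraceOne B.toRepresentation := by
        let π : X →ₗ[k] LinearMap.ker q :=
          (LinearMap.id - f.liftBaseChange k ∘ₗ q).codRestrict _ fun x => by simp [hqf]
        refine h.of_retract (LinearMap.ker q).subtype π (fun g x => rfl) (fun g x => ?_)
          (fun x => Subtype.ext ?_)
        · apply Subtype.ext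
          change ρ g x - f.liftBaseChange k (q (ρ g x)) = ρ g (x - f.liftBaseChange k (q x))
          rw [hq, hΦg, map_sub]
        · simp [π]
      let e := LinearEquiv.ofBijective _ (LinearMap.coprod_ker_bijective _ q hqf)
      have hlt : Module.finrank k B.toSubmodule < d := by
        rw [← hd]
        refine Submodule.finrank_lt fun htop => ?_
        have := IsSimpleModule.nontrivial a[G] T
        obtain ⟨s, hs⟩ := exists_ne (0 : T)
        refine hs (hfj' ?_)
        have h1 : q (f.liftBaseChange k (1 ⊗ₜ j s)) = 0 := by
          have h0 : LinearMap.ker q = ⊤ := htop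
          rw [← LinearMap.mem_ker, h0]
          exact Submodule.mem_top
        rw [hqf] at h1
        have h2 := congrArg (f.liftBaseChange k) h1
        rw [LinearMap.liftBaseChange_tmul, one_smul, map_zero] at h2
        simpa using h2
      have : Module.Finite k B.toSubmodule := inferInstance
      obtain ⟨n, σ₁, f₁, hσ₁, hf₁, hbc⟩ := ih _ hlt hB rfl
      have : Module.Finite a E := inferInstanceAs (Module.Finite a (E.restrictScalars a))
      refine Descends.of_isBaseChange (hE.prod hσ₁)
        (f.coprod (B.toSubmodule.subtype.restrictScalars a ∘ₗ f₁)) (fun g x => ?_) ?_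
      · have h1 := congrArg Subtype.val (hf₁ g x.2)
        simp only [LinearMap.coprod_apply, Representation.prod_apply_apply, map_add,
          LinearMap.comp_apply]
        rw [hf]
        exact congrArg _ h1
      · refine IsBaseChange.of_equiv ((TensorProduct.prodRight a k k E (Fin n → a)).trans
          (((LinearEquiv.refl k _).prodCongr hbc.equiv).trans e)) fun x => ?_
        simp [e, IsBaseChange.equiv_tmul]

end Representation

/-! ### Faithfulness, gluing and finiteness of the image -/

namespace Representation

/-- The kernel of a nonzero projective representation in characteristic `p` contains no elements
of order `p`. -/
theorem HasTraceOne.orderOf_ne {p : ℕ} {k G V : Type*} [Field k] [CharP k p] [Group G] [Fintype G]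
    [AddCommGroup V] [Module k V] [Nontrivial V] {ρ : Representation k G V} (h : HasTraceOne ρ)
    (g : G) (hg : ρ g = 1) : orderOf g ≠ p := by
  classical
  intro hp
  -- The subgroup generated by `g` acts trivially, so its trace is multiplication by its order, here
  -- `p = 0`.
  obtain ⟨θ, hθ⟩ := h.comp (Subgroup.zpowers g).subtype (Subgroup.subtype_injective _)
  obtain ⟨v, hv⟩ := exists_ne (0 : V)
  have h1 : ∀ x : Subgroup.zpowers g, ρ x = 1 := by
    rintro ⟨_, n, rfl⟩
    have : Subgroup.zpowers g ≤ ρ.ker := Subgroup.zpowers_le.2 hg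
    exact this ⟨n, rfl⟩
  have h2 := hθ v
  simp only [MonoidHom.comp_apply, Subgroup.subtype_apply, h1, Module.End.one_apply,
    Finset.sum_const, Finset.card_univ] at h2
  rw [Fintype.card_zpowers, hp, ← Nat.cast_smul_eq_nsmul k, CharP.cast_eq_zero, zero_smul] at h2
  exact hv h2.symm

end Representation

/-- The product `O R` is a `p`-group containing `R`, which already has the order of a Sylow
subgroup. -/
theorem IsPGroup.le_of_normal_of_card_eq {p : ℕ} [Fact p.Prime] {L : Type*} [Group L] [Finite L]
    {O R : Subgroup L} (hO : IsPGroup p O) [O.Normal] (hR : IsPGroup p R) (Q : Sylow p L)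
    (h : Nat.card R = Nat.card Q) : O ≤ R := by
  obtain ⟨Q', hQ'⟩ := (hO.to_sup_of_normal_left hR).exists_le_sylow
  have h1 : Nat.card Q' = Nat.card R := by
    rw [h, Q.card_eq_multiplicity, Q'.card_eq_multiplicity]
  have h2 : R = Q' := Subgroup.eq_of_le_of_card_ge (le_sup_right.trans hQ') h1.le
  rw [h2]
  exact le_sup_left.trans hQ'

theorem AlperinFamily.isPGroup_pCore {p : ℕ} {S : Type*} [Group S] (hS : IsPGroup p S)
    {F : FusionSystem S} {r : ℕ} {L : Fin (r + 1) → Type*} [∀ i, Group (L i)]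
    (A : AlperinFamily p F L) (i : Fin (r + 1)) : IsPGroup p (pCore p (L i)) := by
  rw [← A.map_P i]
  exact ((hS.to_subgroup _).to_subgroup _).map _

theorem MonoidHom.finiteIndex_ker_of_mem_subring {G A : Type*} [Group G] [Ring A] (τ : G →* A)
    (R : Subring A) [Finite R] (h : ∀ x, τ x ∈ R) : τ.ker.FiniteIndex := by
  let τ' : G →* Rˣ := (τ.codRestrict R h).toHomUnits
  have hker : τ'.ker = τ.ker := by
    ext x
    rw [MonoidHom.mem_ker, MonoidHom.mem_ker, Units.ext_iff, Subtype.ext_iff]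
    rfl
  rw [← hker]
  exact Subgroup.finiteIndex_ker τ'

namespace ModelData

variable {p : ℕ} [Fact p.Prime] {S : Type*} [Group S] {F : FusionSystem S} {r : ℕ}
  {L : Fin (r + 1) → Type*} [∀ i, Group (L i)] {A : AlperinFamily p F L}
  {m : Fin (r + 1) → ℕ} (M : ModelData A m)

/-- The copy of `N_S(P_j)` in `K_j` has the order of a Sylow `p`-subgroup of `L_j`, so it contains
every normal `p`-subgroup. -/
theorem pCore_le [∀ i, Finite (L i)] (hS : IsPGroup p S) (j : Σ i, Fin (m i)) :
    pCore p (L j.1) ≤ M.K j := by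
  obtain ⟨Q, hQ⟩ := A.range_incl j.1
  have h1 : Nat.card ((M.ν j).range.map (M.K j).subtype) = Nat.card Q := by
    rw [Subgroup.card_map_of_injective (Subgroup.subtype_injective _), ← hQ,
      ← Nat.card_congr (MonoidHom.ofInjective (M.ν_injective j)).toEquiv,
      ← Nat.card_congr (MonoidHom.ofInjective (A.incl_injective j.1)).toEquiv]
  have h2 : IsPGroup p ((M.ν j).range.map (M.K j).subtype) :=
    ((hS.to_subgroup _).of_surjective _ (M.ν j).rangeRestrict_surjective).map _
  exact ((A.isPGroup_pCore hS j.1).le_of_normal_of_card_eq h2 Q h1).trans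
    (Subgroup.map_subtype_le _)

/-- Nonzero projective representations of the groups `K_j` are faithful. -/
theorem eq_one_of_hasTraceOne [∀ i, Finite (L i)] (hS : IsPGroup p S) (j : Σ i, Fin (m i))
    [Fintype (M.K j)] {k V : Type*} [Field k] [CharP k p]
    [AddCommGroup V] [Module k V] [Nontrivial V]
    {ρ : Representation k (M.K j) V} (h : ρ.HasTraceOne) (g : M.K j) (hg : ρ g = 1) : g = 1 := by
  have hO := A.isPGroup_pCore hS j.1
  have key : ∀ y : M.K j, (y : L j.1) ∈ pCore p (L j.1) → ρ y = 1 → y = 1 := by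
    intro y hy hρy
    by_contra hy1
    obtain ⟨n, hn⟩ := hO ⟨y, hy⟩
    have hn' : y ^ p ^ n = 1 := Subtype.ext (by simpa using congrArg Subtype.val hn)
    have hdvd : p ∣ orderOf y := by
      obtain ⟨l, -, hl⟩ := (Nat.dvd_prime_pow Fact.out).1 (orderOf_dvd_of_pow_eq_one hn')
      rcases Nat.eq_zero_or_pos l with rfl | hl0
      · exact absurd (orderOf_eq_one_iff.1 (hl.trans (pow_zero p))) hy1
      · exact hl ▸ dvd_pow_self p hl0.ne'
    have h1 : orderOf (y ^ (orderOf y / p)) = p :=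
      orderOf_pow_orderOf_div (orderOf_pos y).ne' hdvd
    exact h.orderOf_ne _ (by rw [map_pow, hρy, one_pow]) h1
  -- For `x` in `O_p(L_j)` the commutator of `g` and `x` lies both in `O_p(L_j)` and in the kernel,
  -- so it is trivial by `key`.
  have hcent : (g : L j.1) ∈ Subgroup.centralizer (pCore p (L j.1) : Set (L j.1)) := by
    rw [Subgroup.mem_centralizer_iff]
    intro x hx
    let x' : M.K j := ⟨x, M.pCore_le hS j hx⟩
    have h1 : g * x' * g⁻¹ * x'⁻¹ = 1 := by
      refine key _ ?_ ?_
      · exact (pCore p (L j.1)).mul_mem ((pCore_normal p (L j.1)).conj_mem x hx g)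
          ((pCore p (L j.1)).inv_mem hx)
      · have h2 : ρ g⁻¹ = 1 := by
          have := ρ.map_mul g g⁻¹
          rwa [mul_inv_cancel, map_one, hg, one_mul, eq_comm] at this
        rw [map_mul, map_mul, map_mul, hg, h2, one_mul, mul_one, ← map_mul, mul_inv_cancel,
          map_one]
    have h3 := congrArg Subtype.val (mul_inv_eq_iff_eq_mul.1 (mul_inv_eq_one.1 h1))
    exact h3.symm
  rw [A.centralizer_core] at hcent
  obtain ⟨z, -, hz⟩ := hcent
  exact key g (hz ▸ z.2) hg

/-- Projective representations of the `K_j` on spaces of equal dimension can be glued to a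
representation of the amalgam. -/
theorem exists_glue [Finite S] (hS : IsPGroup p S) [∀ j, Fintype (M.K j)] {a V : Type*} [Field a]
    [CharP a p] [AddCommGroup V] [Module a V] [Module.Finite a V]
    (σ : ∀ j, Representation a (M.K j) V) (hσ : ∀ j, (σ j).HasTraceOne) :
    ∃ τ : Representation a M.G V, ∀ j, ∃ e : V ≃ₗ[a] V, ∀ g x, τ (M.of j g) x =
      e (σ j g (e.symm x)) := by
  -- Two projective modules of the `p`-group `N_S(P_j)` of equal dimension: one restricted from
  -- `K_j`, one from `K_1`.
  have hN : ∀ j : Σ i, Fin (m i), ∃ e : V ≃ₗ[a] V,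
      ∀ (n : Subgroup.normalizer (A.P j.1 : Set S)) (x : V),
        e (σ j (M.ν j n) x) = σ M.base (M.baseEmb n) (e x) := by
    intro j
    have := Fintype.ofFinite (Subgroup.normalizer (A.P j.1 : Set S))
    exact Representation.HasTraceOne.exists_equiv (hS.to_subgroup _)
      ((hσ j).comp (M.ν j) (M.ν_injective j))
      ((hσ M.base).comp (M.baseEmb.comp (Subgroup.subtype _))
        (M.baseEmb_injective.comp (Subgroup.subtype_injective _))) rfl
  choose e he using hN
  let f : ∀ j, M.K j →* Module.End a V := fun j =>
    { toFun := fun g => (e j).conj (σ j g)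
      map_one' := by rw [map_one]; exact LinearEquiv.conj_id _
      map_mul' := fun g h => by rw [map_mul]; exact LinearEquiv.conj_comp _ _ _ }
  have hf : ∀ j g x, f j g x = e j (σ j g ((e j).symm x)) := fun _ _ _ => rfl
  have hfν : ∀ (j : Σ i, Fin (m i)) (n : Subgroup.normalizer (A.P j.1 : Set S)),
      f j (M.ν j n) = σ M.base (M.baseEmb n) := by
    intro j n
    ext x
    rw [hf, he, LinearEquiv.apply_symm_apply]
  refine ⟨M.lift f fun j n => ?_, fun j => ⟨e j, fun g x => ?_⟩⟩
  · rw [hfν]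
    exact (hfν M.base ⟨n, _⟩).symm
  · rw [M.lift_of, hf]

theorem finiteIndex_ker [∀ i, Finite (L i)] {a V : Type*} [Field a] [Algebra (ZMod p) a]
    [Algebra.IsAlgebraic (ZMod p) a] [AddCommGroup V] [Module a V] [Module.Finite a V]
    (τ : Representation a M.G V) : τ.ker.FiniteIndex := by
  obtain ⟨R, hR, hfin⟩ := Module.End.exists_finite_subring (p := p)
    (⋃ j, Set.range fun g : M.K j => τ (M.of j g))
    (Set.finite_iUnion fun j => Set.finite_range _)
  have hτR : ∀ x, τ x ∈ R := by
    intro x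
    induction x using M.induction_on with
    | one => rw [map_one]; exact R.one_mem
    | of j g => exact hR (Set.mem_iUnion.2 ⟨j, g, rfl⟩)
    | mul x y hx hy => rw [map_mul]; exact R.mul_mem hx hy
  exact τ.finiteIndex_ker_of_mem_subring R hτR

end ModelData

/-! ### The module of part (1) -/

namespace ModelData

variable {p : ℕ} [Fact p.Prime] {S : Type*} [Group S] [Finite S] {F : FusionSystem S} {r : ℕ}
  {L : Fin (r + 1) → Type*} [∀ i, Group (L i)] [∀ i, Finite (L i)] {A : AlperinFamily p F L}
  {m : Fin (r + 1) → ℕ} (M : ModelData A m)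

theorem exists_representation (hS : IsPGroup p S) [∀ j, Fintype (M.K j)] (k : Type u) [Field k]
    [CharP k p] (X : (Σ i, Fin (m i)) → Type w) [∀ j, AddCommGroup (X j)] [∀ j, Module k (X j)]
    [∀ j, Module.Finite k (X j)] (ρ : ∀ j, Representation k (M.K j) (X j)) (d : ℕ)
    (hρ : ∀ j, (ρ j).HasTraceOne) (hd : ∀ j, Module.finrank k (X j) = d) :
    ∃ (Y : Type u) (_ : AddCommGroup Y) (_ : Module k Y) (τ : Representation k M.G Y),
      Module.Finite k Y ∧ (∀ j, Nonempty ((M.res τ j).Equiv (ρ j))) ∧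
        τ.ker.FiniteIndex ∧ (0 < d → IsFreeGroup τ.ker) := by
  let _ : Algebra (ZMod p) k := ZMod.algebra k p
  let a := algebraicClosure (ZMod p) k
  have hcl : ∀ x : k, IsIntegral a x → x ∈ (algebraMap a k).range := by
    intro x hx
    have h1 : IsAlgebraic (ZMod p) x := hx.isAlgebraic.restrictScalars (ZMod p)
    exact ⟨⟨x, mem_algebraicClosure_iff.2 h1⟩, rfl⟩
  have hdesc : ∀ j, ∃ (σ : Representation a (M.K j) (Fin d → a)) (f : (Fin d → a) →ₗ[a] X j),
      σ.HasTraceOne ∧ (∀ g x, f (σ g x) = ρ j g (f x)) ∧ IsBaseChange k f := by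
    intro j
    obtain ⟨n, σ, f, hσ, hf, hbc⟩ := (hρ j).descends p (a := a) hcl
    have hn : n = d := by
      rw [← hd j, ← hbc.equiv.finrank_eq]
      simp
    subst hn
    exact ⟨σ, f, hσ, hf, hbc⟩
  choose σ f hσ hf hbc using hdesc
  have : CharP a p := charP_of_injective_algebraMap (algebraMap (ZMod p) a).injective p
  obtain ⟨τ, hτ⟩ := M.exists_glue hS σ hσ
  choose e he using hτ
  have hequiv : ∀ j, Nonempty ((M.res (τ.baseChange k) j).Equiv (ρ j)) := by
    intro j
    refine ⟨.mk (((e j).symm.baseChange a k _ _).trans (hbc j).equiv) fun g => ?_⟩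
    refine TensorProduct.AlgebraTensorModule.ext fun c x => ?_
    change (hbc j).equiv ((e j).symm.baseChange a k _ _ (τ.baseChange k (M.of j g) (c ⊗ₜ x))) = 
      ρ j g ((hbc j).equiv ((e j).symm.baseChange a k _ _ (c ⊗ₜ x)))
    rw [Representation.baseChange_tmul, he, LinearEquiv.baseChange_tmul,
      LinearEquiv.baseChange_tmul, LinearEquiv.symm_apply_apply, IsBaseChange.equiv_tmul,
      IsBaseChange.equiv_tmul, hf, map_smul]
  refine ⟨k ⊗[a] (Fin d → a), inferInstance, inferInstance, τ.baseChange k, inferInstance, hequiv,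
    ?_, fun hd0 => ?_⟩
  · have := M.finiteIndex_ker τ
    refine Subgroup.finiteIndex_of_le (H := τ.ker) fun x hx => ?_
    rw [MonoidHom.mem_ker] at hx ⊢
    change (τ x).baseChange k = 1
    rw [hx]
    exact LinearMap.baseChange_id
  -- The quotient map of `G` by the kernel is injective on each `K_j`, because the nonzero
  -- projective `X_j` is faithful.
  · have hfree := M.isFreeGroup_ker (QuotientGroup.mk' (τ.baseChange k).ker) fun j => by
      rw [injective_iff_map_eq_one]
      intro g hg
      have h1 : M.of j g ∈ (τ.baseChange k).ker := (QuotientGroup.eq_one_iff _).1 hg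
      obtain ⟨φ⟩ := hequiv j
      have h2 : ρ j g = 1 := by
        have h3 : M.res (τ.baseChange k) j g = 1 := h1
        rw [← φ.conj_apply_self g, h3]
        exact LinearEquiv.conj_id _
      have : Nontrivial (X j) := Module.nontrivial_of_finrank_pos (R := k) (by rw [hd j]; exact hd0)
      exact M.eq_one_of_hasTraceOne hS j (hρ j) g h2
    rwa [QuotientGroup.ker_mk'] at hfree

end ModelData

/-! ### Socles and part (2) -/

namespace Representation

section

variable {k G V W : Type*} [Field k] [Group G] [AddCommGroup V] [Module k V]
  [AddCommGroup W] [Module k W]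

theorem socleIsSumOfCopies_of_isIsotypicOfType [Module.Finite k V] (ρ : Representation k G V)
    (σ : Representation k G W) (h : IsIsotypicOfType k[G] ρ.asModule σ.asModule) :
    SocleIsSumOfCopies ρ σ := by
  have : IsSemisimpleModule k[G] (socle k[G] ρ.asModule) := by
    have h1 := isSemisimpleModule_biSup_of_isSemisimpleModule_submodule
      (s := {N : Submodule k[G] ρ.asModule | IsSimpleModule k[G] N}) (p := id)
      (fun N hN => by
        have : IsSimpleModule k[G] N := hN
        exact (inferInstance : IsSemisimpleModule k[G] N))
    rwa [show (⨆ N ∈ {N : Submodule k[G] ρ.asModule | IsSimpleModule k[G] N}, id N) =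
      socle k[G] ρ.asModule from sSup_eq_iSup.symm] at h1
  have hfin : Module.Finite k (socle k[G] ρ.asModule) :=
    inferInstanceAs (Module.Finite k ((socle k[G] ρ.asModule).restrictScalars k))
  have : Module.Finite k[G] (socle k[G] ρ.asModule) := Module.Finite.of_restrictScalars_finite k _ _
  exact (h.of_injective (socle k[G] ρ.asModule).subtype
    (Submodule.injective_subtype _)).linearEquiv_fun

theorem isIsotypicOfType_asModule_of_injective {ρ : Representation k G V}
    {σ : Representation k G W} {T : Type*} [AddCommGroup T] [Module k[G] T]
    (h : IsIsotypicOfType k[G] σ.asModule T) (f : V →ₗ[k] W) (hf : ∀ g x, f (ρ g x) = σ g (f x))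
    (hinj : Function.Injective f) : IsIsotypicOfType k[G] ρ.asModule T :=
  h.of_injective (IntertwiningMap.equivLinearMapAsModule ρ σ
    ⟨f, fun g => LinearMap.ext fun x => hf g x⟩) hinj

end

/-- Some coordinate projection embeds a simple submodule in `E`, where the image of `j` is the only
simple submodule. -/
theorem isIsotypicOfType_pi_of_essential {R E V ι : Type*} [Ring R] [AddCommGroup E] [Module R E]
    [AddCommGroup V] [Module R V] [IsSimpleModule R V] (j : V →ₗ[R] E)
    (hj : Function.Injective j) (hE : ∀ T : Submodule R E, T ≠ ⊥ → LinearMap.range j ≤ T) :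
    IsIsotypicOfType R (ι → E) V := by
  intro T hT
  have := IsSimpleModule.nontrivial R T
  have := IsSimpleModule.nontrivial R V
  obtain ⟨t, ht⟩ := exists_ne (0 : T)
  obtain ⟨i, hi⟩ : ∃ i, (t : ι → E) i ≠ 0 := by
    by_contra! h
    exact ht (Subtype.ext (funext h))
  let q : T →ₗ[R] E := LinearMap.proj i ∘ₗ T.subtype
  have hq : Function.Injective q :=
    (LinearMap.injective_or_eq_zero q).resolve_right fun h => hi (LinearMap.congr_fun h t)
  have h1 : LinearMap.range q ≠ ⊥ := fun h => by
    rw [LinearMap.range_eq_bot] at h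
    exact hi (LinearMap.congr_fun h t)
  have h2 : IsAtom (LinearMap.range q) := isSimpleModule_iff_isAtom.1
    (IsSimpleModule.congr (N := T) (LinearEquiv.ofInjective q hq).symm)
  have h3 : LinearMap.range j ≠ ⊥ := fun h => by
    obtain ⟨v, hv⟩ := exists_ne (0 : V)
    rw [LinearMap.range_eq_bot] at h
    exact hv (hj (by rw [h, LinearMap.zero_apply, LinearMap.zero_apply]))
  have h4 := (h2.le_iff.1 (hE _ h1)).resolve_left h3
  exact ⟨((LinearEquiv.ofInjective q hq).trans (LinearEquiv.ofEq _ _ h4.symm)).trans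
    (LinearEquiv.ofInjective j hj).symm⟩

theorem exists_irreducible_subrepresentation {k G V : Type*} [Field k] [Group G] [AddCommGroup V]
    [Module k V] [Module.Finite k V] [Nontrivial V] (ρ : Representation k G V) :
    ∃ U : Subrepresentation ρ, U.toRepresentation.IsIrreducible := by
  have : Nontrivial ρ.asModule := ‹Nontrivial V›
  have : IsArtinian k[G] ρ.asModule := isArtinian_of_tower k inferInstance
  obtain ⟨T, hT⟩ := IsAtomic.exists_atom (Submodule k[G] ρ.asModule)
  rw [← isSimpleModule_iff_isAtom] at hT
  refine ⟨Subrepresentation.ofSubmodule' T, ?_⟩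
  rw [irreducible_iff_isSimpleModule_asModule]
  let U := Subrepresentation.ofSubmodule' T
  let f : U.toRepresentation.asModule →ₗ[k[G]] ρ.asModule :=
    IntertwiningMap.equivLinearMapAsModule _ _ ⟨U.toSubmodule.subtype, fun g => rfl⟩
  have hf : Function.Injective f := U.toSubmodule.injective_subtype
  have hrange : LinearMap.range f = T := by
    ext x
    exact ⟨fun ⟨y, hy⟩ => hy ▸ y.2, fun hx => ⟨⟨x, hx⟩, rfl⟩⟩
  exact IsSimpleModule.congr (N := T)
    ((LinearEquiv.ofInjective f hf).trans (LinearEquiv.ofEq _ _ hrange))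

end Representation

open Representation in
theorem ModelData.exists_representation_socle {p : ℕ} [Fact p.Prime] {S : Type*} [Group S]
    [Finite S] {F : FusionSystem S} {r : ℕ} {L : Fin (r + 1) → Type*} [∀ i, Group (L i)]
    [∀ i, Finite (L i)] {A : AlperinFamily p F L} {m : Fin (r + 1) → ℕ} (M : ModelData A m)
    (hS : IsPGroup p S) [∀ j, Fintype (M.K j)] (k : Type u) [Field k]
    [CharP k p] (V : (Σ i, Fin (m i)) → Type w) [∀ j, AddCommGroup (V j)] [∀ j, Module k (V j)]
    (σ : ∀ j, Representation k (M.K j) (V j)) (hσ : ∀ j, (σ j).IsIrreducible) :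
    ∃ (W : Type u) (_ : AddCommGroup W) (_ : Module k W) (τ : Representation k M.G W),
      Module.Finite k W ∧ Nontrivial W ∧ (∀ j, (M.res τ j).HasTraceOne) ∧
        ∀ j, IsIsotypicOfType k[M.K j] (M.res τ j).asModule (σ j).asModule := by
  have hsimple : ∀ j, IsSimpleModule k[M.K j] (σ j).asModule := fun j =>
    (irreducible_iff_isSimpleModule_asModule _).1 (hσ j)
  choose E hE i hi hiE using fun j =>
    exists_hull (k := k) (G := M.K j) (σ j).asModule
  have hEfin : ∀ j, Module.Finite k (E j) := fun j =>
    inferInstanceAs (Module.Finite k ((E j).restrictScalars k))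
  have hEpos : ∀ j, 0 < Module.finrank k (E j) := by
    intro j
    have := IsSimpleModule.nontrivial k[M.K j] (σ j).asModule
    have : Nontrivial (E j) := (hi j).nontrivial
    exact Module.finrank_pos
  -- A common multiple of the dimensions of the hulls, so that a suitable power of each hull has
  -- dimension `d`.
  let d := ∏ j, Module.finrank k (E j)
  have hd0 : 0 < d := Finset.prod_pos fun j _ => hEpos j
  let X : (Σ i, Fin (m i)) → Type _ := fun j => Fin (d / Module.finrank k (E j)) → E j
  have hd : ∀ j, Module.finrank k (X j) = d := by
    intro j
    rw [Module.finrank_pi_fintype]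
    simp only [Finset.sum_const, Finset.card_univ, Fintype.card_fin, smul_eq_mul]
    exact Nat.div_mul_cancel (Finset.dvd_prod_of_mem _ (Finset.mem_univ j))
  obtain ⟨W, _, _, τ, hWfin, hequiv, -, -⟩ := M.exists_representation hS k X
    (fun j => (ofModule' (X j) : Representation k (M.K j) (X j))) d (fun j => (hE j).pi) hd
  let φ := fun j => (hequiv j).some
  refine ⟨W, _, _, τ, hWfin, ?_, fun j => ?_, fun j => ?_⟩
  · have h1 : Module.finrank k W = d := (φ M.base).toLinearEquiv.finrank_eq.trans (hd _)
    exact Module.nontrivial_of_finrank_pos (R := k) (h1 ▸ hd0)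
  · exact ((hE j).pi).of_retract (φ j).toLinearEquiv.toLinearMap
      (φ j).toLinearEquiv.symm.toLinearMap
      (fun g x => LinearMap.congr_fun ((φ j).isIntertwining' g) x)
      (fun g x => LinearMap.congr_fun ((φ j).symm.isIntertwining' g) x)
      (φ j).toLinearEquiv.symm_apply_apply
  · let f : (M.res τ j).asModule →ₗ[k[M.K j]] X j :=
      moduleHom ((φ j).toLinearEquiv.toLinearMap ∘ₗ (M.res τ j).asModuleEquiv.toLinearMap)
        fun g x => (congrArg (φ j) ((M.res τ j).asModuleEquiv_ofModule' g x)).trans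
          (LinearMap.congr_fun ((φ j).isIntertwining' g) _)
    exact (isIsotypicOfType_pi_of_essential (i j) (hi j) (hiE j)).of_injective f
      (φ j).toLinearEquiv.injective

theorem mainTheorem10 {p : ℕ} [Fact p.Prime] {S : Type*} [Group S] [Finite S] (hS : IsPGroup p S)
    (F : FusionSystem S) {r : ℕ} (L : Fin (r + 1) → Type*) [∀ i, Group (L i)] [∀ i, Finite (L i)]
    (A : AlperinFamily p F L) {m : Fin (r + 1) → ℕ} (M : ModelData A m)
    (k : Type u) [Field k] [CharP k p] :
    (∀ (X : (Σ i, Fin (m i)) → Type w) [∀ j, AddCommGroup (X j)] [∀ j, Module k (X j)]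
        [∀ j, FiniteDimensional k (X j)] (ρ : ∀ j, Representation k (M.K j) (X j)) (d : ℕ),
      (∀ j, Module.Projective k[M.K j] (ρ j).asModule) →
      (∀ j, Module.finrank k (X j) = d) →
      ∃ (Y : Type u) (_ : AddCommGroup Y) (_ : Module k Y) (τ : Representation k M.G Y),
        (∀ j, Nonempty ((M.res τ j).Equiv (ρ j))) ∧
        τ.ker.Normal ∧ τ.ker.FiniteIndex ∧ (0 < d → IsFreeGroup τ.ker)) ∧
    (∀ (V : (Σ i, Fin (m i)) → Type w) [∀ j, AddCommGroup (V j)] [∀ j, Module k (V j)]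
        (σ : ∀ j, Representation k (M.K j) (V j)),
      (∀ j, (σ j).IsIrreducible) →
      ∃ (W : Type u) (_ : AddCommGroup W) (_ : Module k W) (τ : Representation k M.G W),
        FiniteDimensional k W ∧ Nontrivial W ∧
        (∀ j, Module.Projective k[M.K j] (M.res τ j).asModule) ∧
        (∀ j, SocleIsSumOfCopies (M.res τ j) (σ j)) ∧
        ∃ U : Subrepresentation τ, U.toRepresentation.IsIrreducible ∧
          ∀ j, SocleIsSumOfCopies (M.res U.toRepresentation j) (σ j)) := by
  have := fun j => Fintype.ofFinite (M.K j)
  constructor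
  · intro X _ _ _ ρ d hρ hd
    obtain ⟨Y, hY, hY', τ, -, hequiv, hfin, hfree⟩ := M.exists_representation hS k X ρ d
      (fun j => (Representation.projective_iff_hasTraceOne _).1 (hρ j)) hd
    exact ⟨Y, hY, hY', τ, hequiv, inferInstance, hfin, hfree⟩
  · intro V _ _ σ hσ
    obtain ⟨W, hW, hW', τ, hfin, hnt, htr, hiso⟩ := M.exists_representation_socle hS k V σ hσ
    -- Any simple submodule will do: simple `K_j`-submodules of `U` are also submodules of `W`,
    -- hence isomorphic to `V_j`.
    obtain ⟨U, hU⟩ := Representation.exists_irreducible_subrepresentation τ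
    exact ⟨W, hW, hW', τ, hfin, hnt,
      fun j => (Representation.projective_iff_hasTraceOne _).2 (htr j),
      fun j => Representation.socleIsSumOfCopies_of_isIsotypicOfType _ _ (hiso j), U, hU,
      fun j => Representation.socleIsSumOfCopies_of_isIsotypicOfType _ _
        (Representation.isIsotypicOfType_asModule_of_injective (hiso j) U.toSubmodule.subtype
          (fun _ _ => rfl) U.toSubmodule.injective_subtype)⟩
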